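/- Let $\mathcal A$ be a unital $C^*$-algebra and $\varphi$ a state on $\mathcal A$ (a linear functional with $\varphi(a^*a)\ge 0$ for all $a$ and $\varphi(1)=1$); write $M_k(X)=\varphi(X^k)$. Self-adjoint elements $(x_i)_{i\in I}$ of a unital $*$-algebra with a state $\varphi$, indexed by a linearly ordered set $I$, are called monotone independent if, with $\mathcal A_i$ the (non-unital) $*$-algebra generated by $x_i$, one has $$\varphi(a_1\cdots a_j\cdots a_n)=\varphi(a_j)\,\varphi(a_1\cdots a_{j-1}a_{j+1}\cdots a_n)$$ whenever $n \geq 2$, $a_m\in\mathcal A_{i_m}$, $a_m\notin\mathbb C1$, $i_m\ne i_{m+1}$, and $i_{j-1}<i_j>i_{j+1}$ (one inequality being dropped if $j=1$ or $j=n$). A distribution of a self-adjoint $X$ is a probability measure $\mu$ on $\mathbb R$ with all moments finite and $\int x^k\,\mu(dx)=M_k(X)$ for all $k\ge0$. The monotone cumulants $r_n(\mu)$, $n\ge1$, of a probability measure $\mu$ on $\mathbb R$ with all moments finite are defined as follows: for each $N$ let $Y_1,\dots,Y_N$ be monotone independent self-adjoint elements of some unital $*$-algebra with a state, each with distribution $\mu$;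 the $n$-th moment of $Y_1+\cdots+Y_N$ is a polynomial in $N$, and $r_n(\mu)$ is its coefficient of $N$. Let $\lambda>0$ and let $X_N^{(n)}\in\mathcal A$ $(1\le n\le N,\ 1\le N<\infty)$ be self-adjoint elements such that (1) for each $N$, the elements $X_N^{(1)},\dots,X_N^{(N)}$ are monotone independent and identically distributed, i.e. $M_k(X_N^{(n)})=M_k(X_N^{(1)})$ for all $k$ and all $1\le n\le N$; (2) $N\,M_k(X_N^{(1)})\to\lambda$ as $N\to\infty$ for every $k\ge1$. Then each sum $X_N:=X_N^{(1)}+\cdots+X_N^{(N)}$ has a unique distribution $\mu_N$; there is exactly one probability measure $\nu$ on $\mathbb R$ whose monotone cumulants are all equal to $\lambda$ (the monotone Poisson distribution with parameter $\lambda$); and $\mu_N$ converges weakly to $\nu$ as $N\to\infty$. -/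

import Mathlib

open scoped ComplexOrder
open MeasureTheory Filter Topology

/-- A state on a unital `*`-algebra over `ℂ`. -/
structure IsState {A : Type*} [Ring A] [StarRing A] [Algebra ℂ A] (φ : A →ₗ[ℂ] ℂ) : Prop where
  nonneg : ∀ a : A, 0 ≤ φ (star a * a)
  map_one : φ 1 = 1

/-- Monotone independence of a family of (not necessarily unital) `*`-subalgebras `S i`, indexed by
a linearly ordered set. A word `a₁ ⋯ aₙ` with `aₖ ∈ S (iₖ)` is the list of the pairs `(iₖ, aₖ)`.
If no `aₖ` is a scalar and neighbouring indices differ, then a letter `a` whose index is larger than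
the indices of its (at most two) neighbours factors out:
`φ (a₁ ⋯ a ⋯ aₙ) = φ a * φ (a₁ ⋯ aₙ with a removed)`. -/
def MonotoneIndepAlg {A ι : Type*} [Ring A] [StarRing A] [Algebra ℂ A] [LinearOrder ι]
    (φ : A →ₗ[ℂ] ℂ) (S : ι → NonUnitalStarSubalgebra ℂ A) : Prop :=
  ∀ (u v : List (ι × A)) (i : ι) (a : A),
    (∀ p ∈ u ++ (i, a) :: v, p.2 ∈ S p.1 ∧ p.2 ∉ Set.range (algebraMap ℂ A)) →
    ((u ++ (i, a) :: v).map Prod.fst).IsChain (· ≠ ·) →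
    (∀ p ∈ u.getLast?, p.1 < i) →
    (∀ p ∈ v.head?, p.1 < i) →
    φ ((u ++ (i, a) :: v).map Prod.snd).prod = φ a * φ ((u ++ v).map Prod.snd).prod

/-- Monotone independence of random variables: the non-unital `*`-algebras that they generate are
monotone independent. (With unital algebras the notion would degenerate: inserting `1` of a lower
algebra between elements `b, c` of a higher one would force `φ (b * c) = φ b * φ c`.) -/
def MonotoneIndep {A ι : Type*} [Ring A] [StarRing A] [Algebra ℂ A] [StarModule ℂ A]
    [LinearOrder ι] (φ : A →ₗ[ℂ] ℂ) (X : ι → A) : Prop :=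
  MonotoneIndepAlg φ fun i => NonUnitalStarAlgebra.adjoin ℂ {X i}

/-- `μ` is a distribution of the random variable `a`: all its moments exist and are those of `a`. -/
def HasDistribution {A : Type*} [Ring A] [Algebra ℂ A]
    (φ : A →ₗ[ℂ] ℂ) (a : A) (μ : ProbabilityMeasure ℝ) : Prop :=
  ∀ k : ℕ, Integrable (fun x : ℝ => x ^ k) (μ : Measure ℝ) ∧
    φ (a ^ k) = ((∫ x : ℝ, x ^ k ∂(μ : Measure ℝ) : ℝ) : ℂ)

/-- `r n` (`n ≥ 1`) are the monotone cumulants of the law `μ`: for monotone independent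
self-adjoint random variables `Y₁, …, Y_N` with law `μ` in an algebraic probability space,
the `n`-th moment of `Y₁ + ⋯ + Y_N` is a polynomial in `N`, and `r n` is its coefficient of `N`. -/
def HasMonotoneCumulants (μ : ProbabilityMeasure ℝ) (r : ℕ → ℝ) : Prop :=
  ∃ p : ℕ → Polynomial ℝ, (∀ n : ℕ, 1 ≤ n → (p n).coeff 1 = r n) ∧
    ∀ N : ℕ, ∃ (B : Type) (_ : Ring B) (_ : StarRing B) (_ : Algebra ℂ B) (_ : StarModule ℂ B)
      (ψ : B →ₗ[ℂ] ℂ) (Y : Fin N → B),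
      IsState ψ ∧ (∀ i, IsSelfAdjoint (Y i)) ∧ (∀ i, HasDistribution ψ (Y i) μ) ∧
      MonotoneIndep ψ Y ∧
      ∀ n : ℕ, 1 ≤ n → ψ ((∑ i, Y i) ^ n) = (((p n).eval (N : ℝ) : ℝ) : ℂ)

/-- `μ` is a monotone Poisson distribution with parameter `l`: its monotone cumulants all equal
`l`. -/
def IsMonotonePoisson (l : ℝ) (μ : ProbabilityMeasure ℝ) : Prop :=
  HasMonotoneCumulants μ fun _ => l

/-! The sum of monotone independent variables is governed by composition of series. If `M` is the
moment series of a law, then `X * M` is its Cauchy transform at `1/w`, and monotone convolution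
composes these series (`X_mul_monotoneConv`). Precomposition with `X * M` is linear and upper
triangular in the basis of powers, so truncating it to `d` basis elements gives matrices with
`compMatrix_monotoneIter`: an N-fold convolution is an N-th matrix power. The hypothesis `N * M_k →
l` makes the row matrices `1 + L/N + o(1/N)` with `L` nilpotent, so their N-th powers tend to `exp
L`, and the moments of the row sums converge to the first row of `exp L`, i.e. `poissonSeries l`.

These limiting moments are at most `(2 * exp l) ^ n` (`abs_coeff_poissonSeries_le`). Hence the
moment problem is determinate, and convergence of moments yields a limit law and weak convergence
(`exists_tendsto_of_tendsto_moments`). The laws of the row sums come from the Riesz-Markov theorem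
on the spectrum.

The limit has cumulants `l` because its N-fold power corresponds to `exp (N L)`, a polynomial in `N`
with linear coefficient `L 0 n = l`. Since the definition of cumulants asks for actual variables,
these are built on iterated spaces `L²(ν; H)` (`exists_isMonotoneTower`). Conversely, the n-th
moment enters the n-th moment of the N-fold sum as `N` times itself plus terms in lower moments
(`coeff_monotoneIter_sub`), so the cumulants determine the moments and thus the law.

The bridge from independence to series is `peelRule_of_monotoneIndep`. Its difficulty is that a
power of a nonscalar variable may be scalar, while the independence condition speaks only of
nonscalar letters. -/

/-! ### Monotone convolution as composition of series, and powers of unipotent matrices. -/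

section MonotoneConvolution

open PowerSeries Finset

/-- The matrix of the composition operator `f ↦ f ∘ (X * M)` on power series without constant term,
in the basis `X ^ (j + 1)`, truncated to the first `d` basis elements. -/
noncomputable def compMatrix (d : ℕ) (M : PowerSeries ℝ) : Matrix (Fin d) (Fin d) ℝ :=
  Matrix.of fun j n => coeff (n : ℕ) (X ^ (j : ℕ) * M ^ ((j : ℕ) + 1))

/-- The moment series of the monotone convolution of two laws with moment series `S` and `M`. -/
noncomputable def monotoneConv (S M : PowerSeries ℝ) : PowerSeries ℝ :=
  PowerSeries.mk fun n => ∑ m ∈ range (n + 1), coeff m S * coeff n (X ^ m * M ^ (m + 1))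

/-- The moment series of the `N`-fold monotone convolution power. -/
noncomputable def monotoneIter (M : PowerSeries ℝ) : ℕ → PowerSeries ℝ
  | 0 => 1
  | N + 1 => monotoneConv (monotoneIter M N) M

lemma coeff_X_pow_mul_pow_of_lt (M : PowerSeries ℝ) {n m : ℕ} (h : n < m) (k : ℕ) :
    coeff n (X ^ m * M ^ k) = 0 := by
  rw [coeff_X_pow_mul', if_neg (by omega)]

/-- `(X * M) ^ (m + 1)` has order at least `m + 1`, so only `m ≤ n` contribute and every truncation
`d > n` gives the same value. This is why finite matrices suffice. -/
lemma coeff_subst_X_mul (F M : PowerSeries ℝ) {n d : ℕ} (h : n < d) :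
    coeff (n + 1) ((X * F).subst (X * M)) =
      ∑ m ∈ range d, coeff m F * coeff n (X ^ m * M ^ (m + 1)) := by
  have hs : HasSubst (X * M : PowerSeries ℝ) :=
    HasSubst.of_constantCoeff_zero' (by simp)
  rw [coeff_subst' hs, finsum_eq_sum_of_support_subset (s := range (d + 1)), sum_range_succ']
  · simp only [coeff_succ_X_mul, smul_eq_mul, pow_zero, coeff_zero_X_mul, zero_mul, add_zero]
    refine sum_congr rfl fun m _ => ?_
    rw [← coeff_succ_X_mul n]
    congr 2
    ring
  · intro m hm
    by_contra hc
    simp only [coe_range, Set.mem_Iio, not_lt] at hc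
    refine hm ?_
    simp only [mul_pow]
    rw [coeff_X_pow_mul_pow_of_lt M (by omega), smul_zero]

lemma X_mul_monotoneConv (S M : PowerSeries ℝ) :
    X * monotoneConv S M = (X * S).subst (X * M) := by
  ext n
  rcases n with _ | n
  · rw [coeff_zero_X_mul, coeff_zero_eq_constantCoeff]
    exact (constantCoeff_subst_eq_zero (a := X * M) (by
      change PowerSeries.constantCoeff (X * M) = 0; simp) (X * S) (by simp)).symm
  · rw [coeff_succ_X_mul, coeff_subst_X_mul S M (Nat.lt_succ_self n), monotoneConv, coeff_mk]

/-- Row `j` lists the coefficients of `(X * M) ^ (j + 1)`, shifted by one. Substitution is an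
algebra homomorphism and never lowers the order, so truncation respects products. -/
lemma compMatrix_monotoneConv (d : ℕ) (S M : PowerSeries ℝ) :
    compMatrix d (monotoneConv S M) = compMatrix d S * compMatrix d M := by
  have hs : HasSubst (X * M : PowerSeries ℝ) :=
    HasSubst.of_constantCoeff_zero' (by simp)
  ext j n
  rw [Matrix.mul_apply]
  have h1 : X * (X ^ (j : ℕ) * (monotoneConv S M) ^ ((j : ℕ) + 1)) =
      (X * (X ^ (j : ℕ) * S ^ ((j : ℕ) + 1))).subst (X * M) := by
    calc _ = (X * monotoneConv S M) ^ ((j : ℕ) + 1) := by ring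
      _ = ((X * S) ^ ((j : ℕ) + 1)).subst (X * M) := by
        rw [X_mul_monotoneConv, subst_pow hs]
      _ = _ := by congr 1; ring
  simp only [compMatrix, Matrix.of_apply]
  rw [← coeff_succ_X_mul, h1, coeff_subst_X_mul _ _ n.2, Finset.sum_range]

lemma compMatrix_one (d : ℕ) : compMatrix d 1 = 1 := by
  ext j n
  simp [compMatrix, Matrix.one_apply, coeff_X_pow, Fin.ext_iff, eq_comm]

lemma compMatrix_monotoneIter (d : ℕ) (M : PowerSeries ℝ) (N : ℕ) :
    compMatrix d (monotoneIter M N) = compMatrix d M ^ N := by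
  induction N with
  | zero => simp [monotoneIter, compMatrix_one]
  | succ N ih => rw [monotoneIter, compMatrix_monotoneConv, ih, pow_succ]

lemma coeff_eq_compMatrix (M : PowerSeries ℝ) {d n : ℕ} (h : n < d) :
    coeff n M = compMatrix d M ⟨0, by omega⟩ ⟨n, h⟩ := by
  simp [compMatrix]

/-- Strictly upper triangular matrices. -/
def StrictUpper {d : ℕ} (S : Matrix (Fin d) (Fin d) ℝ) : Prop := ∀ j n, n ≤ j → S j n = 0

lemma StrictUpper.pow_apply {d : ℕ} {S : Matrix (Fin d) (Fin d) ℝ} (hS : StrictUpper S) (k : ℕ)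
    (j n : Fin d) (h : (n : ℕ) < j + k) : (S ^ k) j n = 0 := by
  induction k generalizing n with
  | zero => rw [pow_zero, Matrix.one_apply_ne (by rintro rfl; omega)]
  | succ k ih =>
    rw [pow_succ, Matrix.mul_apply]
    refine sum_eq_zero fun m _ => ?_
    by_cases hm : n ≤ m
    · rw [hS m n hm, mul_zero]
    · rw [ih m (by rw [not_le, Fin.lt_def] at hm; omega), zero_mul]

lemma StrictUpper.pow_eq_zero {d : ℕ} {S : Matrix (Fin d) (Fin d) ℝ} (hS : StrictUpper S) :
    S ^ d = 0 := by
  ext j n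
  exact hS.pow_apply d j n (by omega)

lemma strictUpper_compMatrix_sub_one (d : ℕ) {M : PowerSeries ℝ} (hM : constantCoeff M = 1) :
    StrictUpper (compMatrix d M - 1) := by
  intro j n h
  rw [Matrix.sub_apply, compMatrix, Matrix.of_apply, coeff_X_pow_mul']
  rcases h.eq_or_lt with rfl | h
  · simp [hM]
  · rw [if_neg (by rw [Fin.lt_def] at h; omega), Matrix.one_apply_ne h.ne', sub_zero]

lemma tendsto_choose_div_pow (k : ℕ) :
    Tendsto (fun N : ℕ => (N.choose k : ℝ) / (N : ℝ) ^ k) atTop (𝓝 ((k.factorial : ℝ)⁻¹)) := by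
  have h : Tendsto (fun N : ℕ => (N : ℝ) * (N : ℝ)⁻¹) atTop (𝓝 1) := by
    refine tendsto_const_nhds.congr' ?_
    filter_upwards [eventually_gt_atTop 0] with N hN
    rw [mul_inv_cancel₀ (by positivity)]
  simpa [div_eq_mul_inv] using ProbabilityTheory.tendsto_choose_mul_pow_atTop k h

/-- `(1 + S_N) ^ N → exp L` for strictly upper triangular `S_N` with `N S_N → L`. -/
lemma tendsto_one_add_pow_of_strictUpper {d : ℕ} {S : ℕ → Matrix (Fin d) (Fin d) ℝ}
    {L : Matrix (Fin d) (Fin d) ℝ} (hS : ∀ᶠ N in atTop, StrictUpper (S N))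
    (hL : Tendsto (fun N : ℕ => (N : ℝ) • S N) atTop (𝓝 L)) :
    Tendsto (fun N => (1 + S N) ^ N) atTop
      (𝓝 (∑ k ∈ range d, (k.factorial : ℝ)⁻¹ • L ^ k)) := by
  -- Since `S N ^ d = 0`, the binomial expansion stops at `k < d` for all large `N`, and the limit
  -- can be taken term by term.
  have key : Tendsto (fun N : ℕ => ∑ k ∈ range d,
      ((N.choose k : ℝ) / (N : ℝ) ^ k) • ((N : ℝ) • S N) ^ k) atTop
      (𝓝 (∑ k ∈ range d, (k.factorial : ℝ)⁻¹ • L ^ k)) :=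
    tendsto_finsetSum _ fun k _ => (tendsto_choose_div_pow k).smul (hL.pow k)
  refine key.congr' ?_
  filter_upwards [hS, eventually_ge_atTop d, eventually_gt_atTop 0] with N h hd h0
  rw [add_comm, (Commute.one_right (S N)).add_pow]
  have hsub : range d ⊆ range (N + 1) := range_subset_range.2 (by omega)
  rw [← sum_subset hsub]
  · refine sum_congr rfl fun k _ => ?_
    have : (N : ℝ) ^ k ≠ 0 := by positivity
    rw [smul_pow, smul_smul, div_mul_cancel₀ _ this, one_pow, mul_one, Nat.cast_smul_eq_nsmul,
      nsmul_eq_mul, (Nat.cast_commute _ _).eq]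
  · intro k _ hk
    rw [mem_range, not_lt] at hk
    rw [pow_eq_zero_of_le hk h.pow_eq_zero]
    simp

end MonotoneConvolution

/-! ### The monotone Poisson semigroup, its moments and their growth. -/

section PoissonMoments

open PowerSeries Finset
open scoped PowerSeries.WithPiTopology

/-- The infinitesimal generator of the semigroup of composition matrices of the monotone Poisson
laws: the matrix of the vector field `l * w ^ 2 / (1 - w) * d/dw`. -/
def poissonGenerator (d : ℕ) (l : ℝ) : Matrix (Fin d) (Fin d) ℝ :=
  Matrix.of fun j n => if j < n then ((j : ℕ) + 1) * l else 0

/-- The exponential of `poissonGenerator`. -/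
noncomputable def poissonMatrix (d : ℕ) (l : ℝ) : Matrix (Fin d) (Fin d) ℝ :=
  ∑ k ∈ range d, (k.factorial : ℝ)⁻¹ • poissonGenerator d l ^ k

/-- The moment series of the monotone Poisson law. -/
noncomputable def poissonSeries (l : ℝ) : PowerSeries ℝ :=
  PowerSeries.mk fun n => poissonMatrix (n + 1) l 0 (Fin.last n)

lemma strictUpper_poissonGenerator (d : ℕ) (l : ℝ) : StrictUpper (poissonGenerator d l) := by
  intro j n h
  simp [poissonGenerator, not_lt.2 h]

/-- The derivative of the `j`-th power at `1`, from `M ^ (j + 1) - 1 = (M ^ j - 1) * M + (M - 1)`.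
-/
lemma tendsto_smul_pow_sub_one {M : ℕ → PowerSeries ℝ} {V : PowerSeries ℝ}
    (h : Tendsto (fun N : ℕ => (N : PowerSeries ℝ) * (M N - 1)) atTop (𝓝 V))
    (h1 : Tendsto M atTop (𝓝 1)) (j : ℕ) :
    Tendsto (fun N : ℕ => (N : PowerSeries ℝ) * (M N ^ j - 1)) atTop (𝓝 (j * V)) := by
  induction j with
  | zero => simp
  | succ j ih =>
    have := (ih.mul h1).add h
    rw [mul_one] at this
    push_cast
    rw [add_mul, one_mul]
    refine this.congr fun N => ?_
    ring

/-- Coefficientwise, `N (M N - 1)` tends to `V = l (X + X² + ⋯)`; row `j` of the limit is therefore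
`(j + 1) X ^ j V`. -/
lemma tendsto_smul_compMatrix_sub_one {M : ℕ → PowerSeries ℝ} {l : ℝ}
    (h0 : ∀ᶠ N in atTop, constantCoeff (M N) = 1)
    (h : ∀ k, 1 ≤ k → Tendsto (fun N : ℕ => (N : ℝ) * coeff k (M N)) atTop (𝓝 l)) (d : ℕ) :
    Tendsto (fun N : ℕ => (N : ℝ) • (compMatrix d (M N) - 1)) atTop
      (𝓝 (poissonGenerator d l)) := by
  have hc (N : ℕ) (k : ℕ) (f : PowerSeries ℝ) :
      coeff k ((N : PowerSeries ℝ) * f) = (N : ℝ) * coeff k f := by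
    rw [← map_natCast (C (R := ℝ)) N, coeff_C_mul]
  have hV : Tendsto (fun N : ℕ => (N : PowerSeries ℝ) * (M N - 1)) atTop
      (𝓝 (PowerSeries.mk fun k => if k = 0 then 0 else l)) := by
    rw [WithPiTopology.tendsto_iff_coeff_tendsto]
    intro k
    rw [coeff_mk]
    split_ifs with hk
    · subst hk
      refine tendsto_const_nhds.congr' ?_
      filter_upwards [h0] with N hN
      rw [hc]
      simp [hN]
    · refine (h k (by omega)).congr fun N => ?_
      rw [hc]
      simp [coeff_one, hk]
  have h1 : Tendsto M atTop (𝓝 1) := by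
    rw [WithPiTopology.tendsto_iff_coeff_tendsto]
    intro k
    rcases Nat.eq_zero_or_pos k with rfl | hk
    · refine tendsto_const_nhds.congr' ?_
      filter_upwards [h0] with N hN
      simp [hN]
    · rw [coeff_one, if_neg hk.ne']
      have := (tendsto_inv_atTop_nhds_zero_nat (𝕜 := ℝ)).mul (h k hk)
      rw [zero_mul] at this
      refine this.congr' ?_
      filter_upwards [eventually_gt_atTop 0] with N hN
      field_simp
  refine tendsto_pi_nhds.2 fun j => tendsto_pi_nhds.2 fun n => ?_
  have key := ((WithPiTopology.tendsto_iff_coeff_tendsto _ _ _ _).1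
    ((tendsto_const_nhds (x := (X : PowerSeries ℝ) ^ (j : ℕ))).mul
    (tendsto_smul_pow_sub_one hV h1 ((j : ℕ) + 1)))) n
  convert key using 1
  · ext N
    rw [mul_left_comm, hc, mul_sub, map_sub, mul_one, coeff_X_pow]
    simp [compMatrix, Matrix.one_apply, Fin.ext_iff, eq_comm]
  · rw [mul_left_comm, hc, coeff_X_pow_mul', coeff_mk, poissonGenerator, Matrix.of_apply]
    congr 1
    push_cast
    by_cases hjn : j < n
    · have h' : (j : ℕ) < n := hjn
      rw [if_pos hjn, if_pos h'.le, if_neg (by omega)]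
    · have h' : ¬ (j : ℕ) < n := hjn
      rw [if_neg hjn]
      split_ifs <;> first | omega | simp

lemma tendsto_compMatrix_pow {M : ℕ → PowerSeries ℝ} {l : ℝ}
    (h0 : ∀ᶠ N in atTop, constantCoeff (M N) = 1)
    (h : ∀ k, 1 ≤ k → Tendsto (fun N : ℕ => (N : ℝ) * coeff k (M N)) atTop (𝓝 l)) (d : ℕ) :
    Tendsto (fun N : ℕ => compMatrix d (M N) ^ N) atTop (𝓝 (poissonMatrix d l)) := by
  have := tendsto_one_add_pow_of_strictUpper
    (h0.mono fun N hN => strictUpper_compMatrix_sub_one d hN)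
    (tendsto_smul_compMatrix_sub_one h0 h d)
  simpa [poissonMatrix] using this

lemma tendsto_coeff_monotoneIter {M : ℕ → PowerSeries ℝ} {l : ℝ}
    (h0 : ∀ᶠ N in atTop, constantCoeff (M N) = 1)
    (h : ∀ k, 1 ≤ k → Tendsto (fun N : ℕ => (N : ℝ) * coeff k (M N)) atTop (𝓝 l)) (n : ℕ) :
    Tendsto (fun N : ℕ => coeff n (monotoneIter (M N) N)) atTop
      (𝓝 (coeff n (poissonSeries l))) := by
  have := tendsto_pi_nhds.1 (tendsto_pi_nhds.1 (tendsto_compMatrix_pow h0 h (n + 1)) 0)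
    (Fin.last n)
  rw [poissonSeries, coeff_mk]
  refine this.congr fun N => ?_
  rw [← compMatrix_monotoneIter, coeff_eq_compMatrix _ (Nat.lt_succ_self n)]
  rfl

/-- `poissonSeries` records only the first rows of exponentials; the other rows must be shown to
come from powers of it. Composition matrices form a closed set, so it is enough to exhibit the
exponential as a limit of them, here with the series `1 + (l/N)(X + X² + ⋯)`. -/
lemma compMatrix_poissonSeries (d : ℕ) (l : ℝ) :
    compMatrix d (poissonSeries l) = poissonMatrix d l := by
  let M : ℕ → PowerSeries ℝ := fun N => PowerSeries.mk fun k => if k = 0 then 1 else l / N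
  have h0 : ∀ᶠ N in atTop, constantCoeff (M N) = 1 := by
    refine Eventually.of_forall fun N => ?_
    rw [← coeff_zero_eq_constantCoeff_apply]
    simp [M]
  have h : ∀ k, 1 ≤ k → Tendsto (fun N : ℕ => (N : ℝ) * coeff k (M N)) atTop (𝓝 l) := by
    intro k hk
    refine tendsto_const_nhds.congr' ?_
    filter_upwards [eventually_gt_atTop 0] with N hN
    simp only [M, coeff_mk, if_neg (show k ≠ 0 by omega)]
    field_simp
  have hS : Tendsto (fun N => monotoneIter (M N) N) atTop (𝓝 (poissonSeries l)) := by
    rw [WithPiTopology.tendsto_iff_coeff_tendsto]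
    exact tendsto_coeff_monotoneIter h0 h
  have hT : Tendsto (fun N => compMatrix d (monotoneIter (M N) N)) atTop
      (𝓝 (compMatrix d (poissonSeries l))) := by
    refine tendsto_pi_nhds.2 fun j => tendsto_pi_nhds.2 fun n => ?_
    exact (WithPiTopology.tendsto_iff_coeff_tendsto _ _ _ _).1
      (tendsto_const_nhds.mul (hS.pow ((j : ℕ) + 1))) n
  simp only [compMatrix_monotoneIter] at hT
  exact tendsto_nhds_unique hT (tendsto_compMatrix_pow h0 h d)

lemma poissonMatrix_eq_exp (d : ℕ) (l : ℝ) :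
    poissonMatrix d l = IsNilpotent.exp (poissonGenerator d l) := by
  rw [IsNilpotent.exp_eq_sum (strictUpper_poissonGenerator d l).pow_eq_zero, poissonMatrix]
  refine sum_congr rfl fun k _ => ?_
  ext i j
  simp [Rat.smul_def]

lemma exp_nsmul_of_isNilpotent {A : Type*} [Ring A] [Module ℚ A] {a : A} (h : IsNilpotent a)
    (N : ℕ) : IsNilpotent.exp (N • a) = IsNilpotent.exp a ^ N := by
  induction N with
  | zero => simp
  | succ N ih =>
    rw [succ_nsmul, IsNilpotent.exp_add_of_commute ((Commute.refl a).smul_left N)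
      (h.smul N) h, ih, pow_succ]

/-- The N-fold convolution has matrix `(exp L) ^ N = exp (N L)`, a polynomial in `N` because `L` is
nilpotent. -/
lemma coeff_monotoneIter_poissonSeries (l : ℝ) (N n : ℕ) :
    coeff n (monotoneIter (poissonSeries l) N) = ∑ k ∈ range (n + 1),
      ((k.factorial : ℝ)⁻¹ * (poissonGenerator (n + 1) l ^ k) 0 (Fin.last n)) * (N : ℝ) ^ k := by
  have hL := (strictUpper_poissonGenerator (n + 1) l).pow_eq_zero
  rw [coeff_eq_compMatrix _ (Nat.lt_succ_self n), compMatrix_monotoneIter,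
    compMatrix_poissonSeries, poissonMatrix_eq_exp, ← exp_nsmul_of_isNilpotent ⟨_, hL⟩,
    IsNilpotent.exp_eq_sum (k := n + 1) (by rw [smul_pow, hL, smul_zero]), Matrix.sum_apply]
  refine sum_congr rfl fun k _ => ?_
  rw [smul_pow, Matrix.smul_apply, Matrix.smul_apply, Rat.smul_def, nsmul_eq_mul]
  push_cast
  rw [mul_comm ((N : ℝ) ^ k), ← mul_assoc]
  rfl

/-- The `n`-th moment of a sum of `N` monotone independent monotone Poisson variables, as a
polynomial in `N`. -/
noncomputable def poissonPolynomial (l : ℝ) (n : ℕ) : Polynomial ℝ :=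
  ∑ k ∈ range (n + 1), Polynomial.C
    ((k.factorial : ℝ)⁻¹ * (poissonGenerator (n + 1) l ^ k) 0 (Fin.last n)) * Polynomial.X ^ k

lemma eval_poissonPolynomial (l : ℝ) (n N : ℕ) :
    (poissonPolynomial l n).eval (N : ℝ) = coeff n (monotoneIter (poissonSeries l) N) := by
  rw [coeff_monotoneIter_poissonSeries, poissonPolynomial, Polynomial.eval_finsetSum]
  simp

lemma coeff_one_poissonPolynomial (l : ℝ) {n : ℕ} (hn : 1 ≤ n) :
    (poissonPolynomial l n).coeff 1 = l := by
  simp only [poissonPolynomial, Polynomial.finsetSum_coeff, Polynomial.coeff_C_mul,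
    Polynomial.coeff_X_pow]
  rw [sum_eq_single 1]
  · have h : (0 : Fin (n + 1)) < Fin.last n := Fin.mk_lt_mk.2 hn
    simp [poissonGenerator, if_pos h]
  · intro b _ hb
    simp [hb.symm]
  · simp; omega

lemma poissonGenerator_pow_apply_nonneg {l : ℝ} (hl : 0 ≤ l) (d k : ℕ) (i j : Fin d) :
    0 ≤ (poissonGenerator d l ^ k) i j := by
  induction k generalizing j with
  | zero => rw [pow_zero, Matrix.one_apply]; split_ifs <;> norm_num
  | succ k ih =>
    rw [pow_succ, Matrix.mul_apply]
    refine sum_nonneg fun m _ => mul_nonneg (ih m) ?_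
    simp only [poissonGenerator, Matrix.of_apply]
    split_ifs <;> positivity

lemma sum_range_choose_fixed (n k : ℕ) :
    ∑ m ∈ range n, m.choose k = n.choose (k + 1) := by
  induction n with
  | zero => simp
  | succ n ih => rw [sum_range_succ, ih, Nat.choose_succ_succ, add_comm]

/-- The entry sums over chains of `k` increasing steps from `0` to `n`: at most `n.choose k` of
them, each step weighing at most `l * n`. The hockey-stick identity carries the induction. -/
lemma poissonGenerator_pow_apply_le {l : ℝ} (hl : 0 ≤ l) (d k : ℕ) (n : Fin (d + 1)) :
    (poissonGenerator (d + 1) l ^ k) 0 n ≤ (n : ℕ).choose k * (l * n) ^ k := by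
  induction k generalizing n with
  | zero =>
    rw [pow_zero, Matrix.one_apply]
    split_ifs <;> simp
  | succ k ih =>
    rw [pow_succ, Matrix.mul_apply]
    have h1 : ∀ m : Fin (d + 1),
        (poissonGenerator (d + 1) l ^ k) 0 m * poissonGenerator (d + 1) l m n ≤
        if (m : ℕ) < n then ((m : ℕ).choose k : ℝ) * (l * n) ^ (k + 1) else 0 := by
      intro m
      rw [show poissonGenerator (d + 1) l m n = if m < n then ((m : ℕ) + 1) * l else 0 from rfl]
      by_cases hm : m < n
      · have hm' : (m : ℕ) < n := hm
        rw [if_pos hm, if_pos hm', pow_succ (l * ((n : ℕ) : ℝ)), ← mul_assoc ((m : ℕ).choose k : ℝ)]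
        have h2 : ((m : ℕ) : ℝ) + 1 ≤ (n : ℕ) := by exact_mod_cast hm'
        have h3 : ((m : ℕ) : ℝ) ≤ (n : ℕ) := by linarith
        refine mul_le_mul ((ih m).trans ?_) ?_ (by positivity) (by positivity)
        · gcongr
        · rw [mul_comm]; gcongr
      · have hm' : ¬ (m : ℕ) < n := hm
        rw [if_neg hm, if_neg hm', mul_zero]
    refine (sum_le_sum fun m _ => h1 m).trans (le_of_eq ?_)
    rw [Fin.sum_univ_eq_sum_range
      (fun m => if m < (n : ℕ) then ((m.choose k : ℕ) : ℝ) * (l * n) ^ (k + 1) else 0),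
      ← sum_filter, ← sum_mul]
    congr 1
    have : (range (d + 1)).filter (· < (n : ℕ)) = range n := by
      ext m; simp only [mem_filter, mem_range]; omega
    rw [this]
    rw [← sum_range_choose_fixed]
    push_cast
    rfl

/-- Each `(l n) ^ k / k!` is at most `exp (l n)`, and the binomial coefficients sum to `2 ^ n`. -/
lemma abs_coeff_poissonSeries_le {l : ℝ} (hl : 0 ≤ l) (n : ℕ) :
    |coeff n (poissonSeries l)| ≤ (2 * Real.exp l) ^ n := by
  have hnn : 0 ≤ coeff n (poissonSeries l) := by
    rw [poissonSeries, coeff_mk, poissonMatrix, Matrix.sum_apply]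
    exact sum_nonneg fun k _ => mul_nonneg (by positivity)
      (poissonGenerator_pow_apply_nonneg hl _ _ _ _)
  rw [abs_of_nonneg hnn, poissonSeries, coeff_mk, poissonMatrix, Matrix.sum_apply]
  calc _ ≤ ∑ k ∈ range (n + 1), (n.choose k : ℝ) * Real.exp (l * n) := by
        refine sum_le_sum fun k _ => ?_
        rw [Matrix.smul_apply, smul_eq_mul]
        have h1 := poissonGenerator_pow_apply_le hl n k (Fin.last n)
        have h2 := Real.pow_div_factorial_le_exp (x := l * n) (by positivity) k
        rw [Fin.val_last] at h1
        calc _ ≤ (k.factorial : ℝ)⁻¹ * (n.choose k * (l * n) ^ k) := by gcongr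
          _ = n.choose k * ((l * n) ^ k / k.factorial) := by ring
          _ ≤ _ := by gcongr
    _ = (2 * Real.exp l) ^ n := by
        rw [← sum_mul, ← Nat.cast_sum, Nat.sum_range_choose, mul_pow, ← Real.exp_nat_mul,
          mul_comm l]
        push_cast
        rfl

end PoissonMoments

/-! ### Moments of geometric growth: determinacy and the method of moments. -/

section MomentProblem

/-- The sequence `a` is the moment sequence of `μ`. -/
def HasMoments (μ : ProbabilityMeasure ℝ) (a : ℕ → ℝ) : Prop :=
  ∀ k : ℕ, Integrable (fun x : ℝ => x ^ k) (μ : Measure ℝ) ∧ ∫ x : ℝ, x ^ k ∂(μ : Measure ℝ) = a k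

/-- The derivative of the remainder of order `n + 1` is `I` times the remainder of order `n`, so the
bound integrates up. -/
lemma norm_exp_mul_I_sub_sum_le_of_nonneg (n : ℕ) {x : ℝ} (hx : 0 ≤ x) :
    ‖Complex.exp (x * Complex.I) - ∑ k ∈ Finset.range n, (x * Complex.I) ^ k / k.factorial‖ ≤
      x ^ n / n.factorial := by
  induction n generalizing x with
  | zero => simp [Complex.norm_exp_ofReal_mul_I]
  | succ n ih =>
    have hder : ∀ y : ℝ, HasDerivAt (fun y : ℝ => Complex.exp (y * Complex.I) -
        ∑ k ∈ Finset.range (n + 1), (y * Complex.I) ^ k / k.factorial)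
        (Complex.I * (Complex.exp (y * Complex.I) -
          ∑ k ∈ Finset.range n, (y * Complex.I) ^ k / k.factorial)) y := by
      intro y
      have h1 : HasDerivAt (fun y : ℝ => (y : ℂ) * Complex.I) Complex.I y := by
        simpa using (Complex.ofRealCLM.hasDerivAt (x := y)).mul_const Complex.I
      have h2 := h1.cexp.sub (HasDerivAt.fun_sum (u := Finset.range (n + 1))
        fun k _ => (h1.pow k).div_const (k.factorial : ℂ))
      refine h2.congr_deriv ?_
      rw [Finset.sum_range_succ', mul_sub, Finset.mul_sum]
      simp only [Nat.cast_zero, zero_mul, zero_div, add_zero]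
      congr 1
      · ring
      · refine Finset.sum_congr rfl fun k _ => ?_
        rw [Nat.factorial_succ]
        have : (k.factorial : ℂ) ≠ 0 := by exact_mod_cast k.factorial_ne_zero
        have : (k : ℂ) + 1 ≠ 0 := by exact_mod_cast k.succ_ne_zero
        push_cast
        field_simp
    have hB : ∀ y : ℝ, HasDerivAt (fun y : ℝ => y ^ (n + 1) / (n + 1).factorial)
        (y ^ n / n.factorial) y := by
      intro y
      refine ((hasDerivAt_pow (n + 1) y).div_const _).congr_deriv ?_
      rw [Nat.factorial_succ]
      push_cast
      field_simp
    refine image_norm_le_of_norm_deriv_right_le_deriv_boundary (a := 0) (b := x)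
      (fun y _ => (hder y).continuousAt.continuousWithinAt)
      (fun y _ => (hder y).hasDerivWithinAt) ?_ hB ?_ ⟨hx, le_rfl⟩
    · rw [Finset.sum_range_succ']
      simp
    · intro y hy
      rw [norm_mul, Complex.norm_I, one_mul]
      exact ih hy.1

lemma norm_exp_mul_I_sub_sum_le (n : ℕ) (x : ℝ) :
    ‖Complex.exp (x * Complex.I) - ∑ k ∈ Finset.range n, (x * Complex.I) ^ k / k.factorial‖ ≤
      |x| ^ n / n.factorial := by
  rcases le_total 0 x with hx | hx
  · rw [abs_of_nonneg hx]
    exact norm_exp_mul_I_sub_sum_le_of_nonneg n hx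
  · rw [abs_of_nonpos hx]
    refine le_of_eq_of_le ?_ (norm_exp_mul_I_sub_sum_le_of_nonneg n (neg_nonneg.2 hx))
    rw [← RCLike.norm_conj]
    congr 1
    rw [map_sub, ← Complex.exp_conj, map_sum]
    simp

/-- An even Taylor order makes the error `|x| ^ (2 * m) = x ^ (2 * m)` a genuine moment. -/
lemma HasMoments.norm_charFun_sub_sum_le {μ : ProbabilityMeasure ℝ} {a : ℕ → ℝ}
    (h : HasMoments μ a) (t : ℝ) (m : ℕ) :
    ‖charFun (μ : Measure ℝ) t -
      ∑ k ∈ Finset.range (2 * m), (t * Complex.I) ^ k / k.factorial * a k‖ ≤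
      |t| ^ (2 * m) / (2 * m).factorial * a (2 * m) := by
  have hInt : ∀ k : ℕ, Integrable
      (fun x : ℝ => (t * Complex.I) ^ k / k.factorial * ((x ^ k : ℝ) : ℂ)) (μ : Measure ℝ) :=
    fun k => ((h k).1.ofReal (𝕜 := ℂ)).const_mul _
  have hsum : ∑ k ∈ Finset.range (2 * m), (t * Complex.I) ^ k / k.factorial * (a k : ℂ) =
      ∫ x : ℝ, ∑ k ∈ Finset.range (2 * m),
        (t * Complex.I) ^ k / k.factorial * ((x ^ k : ℝ) : ℂ) ∂(μ : Measure ℝ) := by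
    rw [integral_finsetSum _ fun k _ => hInt k]
    refine Finset.sum_congr rfl fun k _ => ?_
    rw [integral_const_mul, integral_complex_ofReal, (h k).2]
  have hexp : Integrable (fun x : ℝ => Complex.exp (t * x * Complex.I)) (μ : Measure ℝ) := by
    refine (integrable_const (1 : ℝ)).mono' (by fun_prop) (Eventually.of_forall fun x => ?_)
    rw [← Complex.ofReal_mul, Complex.norm_exp_ofReal_mul_I]
  rw [charFun_apply_real, hsum, ← integral_sub hexp (integrable_finsetSum _ fun k _ => hInt k)]
  have hb : ∀ x : ℝ, ‖Complex.exp (t * x * Complex.I) - ∑ k ∈ Finset.range (2 * m),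
      (t * Complex.I) ^ k / k.factorial * ((x ^ k : ℝ) : ℂ)‖ ≤
      |t| ^ (2 * m) / (2 * m).factorial * x ^ (2 * m) := by
    intro x
    have := norm_exp_mul_I_sub_sum_le (2 * m) (t * x)
    rw [abs_mul, mul_pow, (even_two_mul m).pow_abs x] at this
    convert this using 1
    · congr 2
      · push_cast; rfl
      · refine Finset.sum_congr rfl fun k _ => ?_
        push_cast
        ring
    · ring
  refine (norm_integral_le_of_norm_le ((h (2 * m)).1.const_mul _)
    (Eventually.of_forall hb)).trans ?_
  rw [integral_const_mul, (h (2 * m)).2]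

/-- Convergence of moments to those of a law whose moments grow at most geometrically implies weak
convergence. -/
lemma tendsto_of_tendsto_moments {μ : ℕ → ProbabilityMeasure ℝ} {m : ℕ → ℕ → ℝ}
    (hμ : ∀ N, HasMoments (μ N) (m N)) {ν : ProbabilityMeasure ℝ} {a : ℕ → ℝ}
    (hν : HasMoments ν a) {C : ℝ} (hC : ∀ k, |a k| ≤ C ^ k)
    (hm : ∀ k, Tendsto (fun N => m N k) atTop (𝓝 (a k))) : Tendsto μ atTop (𝓝 ν) := by
  refine ProbabilityMeasure.tendsto_of_tendsto_charFun fun t => ?_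
  rw [Metric.tendsto_atTop]
  intro ε hε
  -- Two Taylor errors are added: `C ^ (2 * p)` bounds the moment of `ν`, and `C ^ (2 * p) + 1` that
  -- of `μ N` for large `N`.
  have hfac : Tendsto (fun p : ℕ => |t| ^ (2 * p) / (2 * p).factorial * (2 * C ^ (2 * p) + 1))
      atTop (𝓝 0) := by
    have h1 := (FloorSemiring.tendsto_pow_div_factorial_atTop (|t| * C)).comp
      (tendsto_id.const_mul_atTop' (two_pos (α := ℕ)))
    have h2 := (FloorSemiring.tendsto_pow_div_factorial_atTop |t|).comp
      (tendsto_id.const_mul_atTop' (two_pos (α := ℕ)))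
    have h3 := (h1.const_mul 2).add h2
    rw [mul_zero, add_zero] at h3
    refine h3.congr fun p => ?_
    simp only [Function.comp, id]
    ring
  obtain ⟨p, hp⟩ := (hfac.eventually_lt_const (half_pos hε)).exists
  have hsum : Tendsto (fun N => ‖∑ k ∈ Finset.range (2 * p),
      (t * Complex.I) ^ k / k.factorial * (m N k : ℂ) - ∑ k ∈ Finset.range (2 * p),
      (t * Complex.I) ^ k / k.factorial * (a k : ℂ)‖) atTop (𝓝 0) := by
    rw [← tendsto_iff_norm_sub_tendsto_zero]
    exact tendsto_finsetSum _ fun k _ =>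
      ((Complex.continuous_ofReal.tendsto _).comp (hm k)).const_mul _
  obtain ⟨N₀, hN₀⟩ := eventually_atTop.1 ((hsum.eventually_lt_const (half_pos hε)).and
    ((hm (2 * p)).eventually_lt_const (lt_add_one _)))
  refine ⟨N₀, fun N hN => ?_⟩
  obtain ⟨e1, e2⟩ := hN₀ N hN
  have e3 := (hμ N).norm_charFun_sub_sum_le t p
  have e4 := hν.norm_charFun_sub_sum_le t p
  have e5 : a (2 * p) ≤ C ^ (2 * p) := (le_abs_self _).trans (hC _)
  have e6 : 0 ≤ |t| ^ (2 * p) / (2 * p).factorial := by positivity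
  rw [dist_eq_norm]
  set s₁ := ∑ k ∈ Finset.range (2 * p), (t * Complex.I) ^ k / k.factorial * (m N k : ℂ)
  set s₂ := ∑ k ∈ Finset.range (2 * p), (t * Complex.I) ^ k / k.factorial * (a k : ℂ)
  calc _ = ‖(charFun (μ N : Measure ℝ) t - s₁) + (s₁ - s₂) - (charFun (ν : Measure ℝ) t - s₂)‖ := by
        congr 1; ring
    _ ≤ ‖charFun (μ N : Measure ℝ) t - s₁‖ + ‖s₁ - s₂‖ + ‖charFun (ν : Measure ℝ) t - s₂‖ :=
        (norm_sub_le _ _).trans (by gcongr; exact norm_add_le _ _)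
    _ < ε := by nlinarith [mul_le_mul_of_nonneg_left e5 e6, mul_le_mul_of_nonneg_left e2.le e6]

/-- A law whose moments grow at most geometrically is determined by them. -/
lemma HasMoments.unique {μ ν : ProbabilityMeasure ℝ} {a : ℕ → ℝ} (hμ : HasMoments μ a)
    (hν : HasMoments ν a) {C : ℝ} (hC : ∀ k, |a k| ≤ C ^ k) : μ = ν :=
  tendsto_nhds_unique (tendsto_const_nhds (f := atTop (α := ℕ)))
    (tendsto_of_tendsto_moments (μ := fun _ => μ) (fun _ => hμ) hν hC fun _ => tendsto_const_nhds)

/-- Chebyshev's inequality with bounded second moments gives tightness; then Prokhorov's theorem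
applies. -/
lemma exists_subseq_tendsto_of_moments {μ : ℕ → ProbabilityMeasure ℝ} {m : ℕ → ℕ → ℝ}
    (hμ : ∀ N, HasMoments (μ N) (m N)) {K : ℝ} (hK : ∀ N, m N 2 ≤ K) :
    ∃ (ν : ProbabilityMeasure ℝ) (f : ℕ → ℕ), StrictMono f ∧ Tendsto (μ ∘ f) atTop (𝓝 ν) := by
  have htight : IsTightMeasureSet {((ρ : ProbabilityMeasure ℝ) : Measure ℝ) | ρ ∈ Set.range μ} := by
    refine isTightMeasureSet_of_tendsto_measure_norm_gt ?_
    have hlim : Tendsto (fun r : ℝ => ENNReal.ofReal (K / r ^ 2)) atTop (𝓝 0) := by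
      rw [← ENNReal.ofReal_zero]
      refine ENNReal.tendsto_ofReal ?_
      exact tendsto_const_nhds.div_atTop (tendsto_pow_atTop two_ne_zero)
    refine tendsto_of_tendsto_of_tendsto_of_le_of_le' tendsto_const_nhds hlim
      (Eventually.of_forall fun _ => zero_le) ?_
    filter_upwards [eventually_gt_atTop 0] with r hr
    refine iSup₂_le ?_
    rintro _ ⟨_, ⟨N, rfl⟩, rfl⟩
    have hr2 : 0 < r ^ 2 := by positivity
    have h1 := mul_meas_ge_le_integral_of_nonneg (μ := (μ N : Measure ℝ))
      (f := fun x : ℝ => x ^ 2) (Eventually.of_forall fun x => sq_nonneg x) (hμ N 2).1 (r ^ 2)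
    rw [(hμ N 2).2] at h1
    have h2 : (μ N : Measure ℝ).real {x | r ^ 2 ≤ x ^ 2} ≤ K / r ^ 2 := by
      rw [le_div_iff₀ hr2, mul_comm]
      exact h1.trans (hK N)
    calc (μ N : Measure ℝ) {x | r < ‖x‖} ≤ (μ N : Measure ℝ) {x | r ^ 2 ≤ x ^ 2} := by
          refine measure_mono fun x hx => ?_
          have hx' : r < |x| := hx
          change r ^ 2 ≤ x ^ 2
          rw [← sq_abs x]
          gcongr
      _ = ENNReal.ofReal ((μ N : Measure ℝ).real {x | r ^ 2 ≤ x ^ 2}) := by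
          rw [ofReal_measureReal]
      _ ≤ _ := ENNReal.ofReal_le_ofReal h2
  obtain ⟨ν, -, f, hf, hν⟩ := (isCompact_closure_of_isTightMeasureSet htight).tendsto_subseq
    (x := μ) fun N => subset_closure ⟨N, rfl⟩
  exact ⟨ν, f, hf, hν⟩

lemma lintegral_le_of_tendsto {μ : ℕ → ProbabilityMeasure ℝ} {ν : ProbabilityMeasure ℝ}
    (hμ : Tendsto μ atTop (𝓝 ν)) {f : ℝ → ℝ} (hf : Continuous f) (h0 : 0 ≤ f) {c : ℝ}
    (hInt : ∀ N, Integrable f (μ N : Measure ℝ))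
    (hc : Tendsto (fun N => ∫ x, f x ∂(μ N : Measure ℝ)) atTop (𝓝 c)) :
    ∫⁻ x, ENNReal.ofReal (f x) ∂(ν : Measure ℝ) ≤ ENNReal.ofReal c := by
  have h1 := lintegral_le_liminf_lintegral_of_forall_isOpen_measure_le_liminf_measure hf h0
    (μ := (ν : Measure ℝ)) (μs := fun N => (μ N : Measure ℝ))
    fun G hG => ProbabilityMeasure.le_liminf_measure_open_of_tendsto hμ hG
  refine h1.trans (le_of_eq ?_)
  refine Tendsto.liminf_eq ?_
  refine (ENNReal.tendsto_ofReal hc).congr fun N => ?_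
  rw [ofReal_integral_eq_lintegral_ofReal (hInt N) (Eventually.of_forall h0)]

/-- Weak convergence gives only a Fatou inequality for nonnegative continuous functions. Applied to
the completed squares `ε x^(2k) ± x^k + 1/(4ε)`, it bounds the `k`-th moment from both sides up to
`ε * a (2 * k)`; then `ε → 0`. -/
lemma hasMoments_of_tendsto {μ : ℕ → ProbabilityMeasure ℝ} {m : ℕ → ℕ → ℝ}
    (hμ : ∀ N, HasMoments (μ N) (m N)) {ν : ProbabilityMeasure ℝ} {a : ℕ → ℝ}
    (hν : Tendsto μ atTop (𝓝 ν)) (hm : ∀ k, Tendsto (fun N => m N k) atTop (𝓝 (a k))) :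
    HasMoments ν a := by
  have hle : ∀ {f : ℝ → ℝ} (_ : Continuous f) (_ : 0 ≤ f) {c : ℝ}
      (_ : ∀ N, Integrable f (μ N : Measure ℝ))
      (_ : Tendsto (fun N => ∫ x, f x ∂(μ N : Measure ℝ)) atTop (𝓝 c)),
      Integrable f (ν : Measure ℝ) ∧ ∫ x, f x ∂(ν : Measure ℝ) ≤ c := by
    intro f hf h0 c hInt hc
    have h1 := lintegral_le_of_tendsto hν hf h0 hInt hc
    have hi : Integrable f (ν : Measure ℝ) := by
      refine ⟨hf.aestronglyMeasurable, ?_⟩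
      rw [hasFiniteIntegral_iff_ofReal (Eventually.of_forall h0)]
      exact h1.trans_lt ENNReal.ofReal_lt_top
    have hc0 : 0 ≤ c := ge_of_tendsto' hc fun N => integral_nonneg h0
    refine ⟨hi, ?_⟩
    rw [← ofReal_integral_eq_lintegral_ofReal hi (Eventually.of_forall h0)] at h1
    exact (ENNReal.ofReal_le_ofReal_iff hc0).1 h1
  have heven : ∀ k : ℕ, Integrable (fun x : ℝ => x ^ (2 * k)) (ν : Measure ℝ) := fun k =>
    (hle (by fun_prop) (fun x => (even_two_mul k).pow_nonneg x) (fun N => (hμ N (2 * k)).1)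
      ((hm (2 * k)).congr fun N => (hμ N (2 * k)).2.symm)).1
  have hInt : ∀ k : ℕ, Integrable (fun x : ℝ => x ^ k) (ν : Measure ℝ) := by
    intro k
    refine ((integrable_const (1 : ℝ)).add (heven k)).mono' (by fun_prop)
      (Eventually.of_forall fun x => ?_)
    simp only [Pi.add_apply, Real.norm_eq_abs]
    rw [mul_comm, pow_mul]
    nlinarith [sq_nonneg (|x ^ k| - 1), sq_abs (x ^ k), sq_nonneg (x ^ k)]
  refine fun k => ⟨hInt k, ?_⟩
  have hkey : ∀ s : ℝ, s ^ 2 = 1 → ∀ ε : ℝ, 0 < ε →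
      s * (∫ x, x ^ k ∂(ν : Measure ℝ) - a k) ≤ ε * a (2 * k) := by
    intro s hs ε hε
    have hI : ∀ ρ : ProbabilityMeasure ℝ, Integrable (fun x : ℝ => x ^ k) (ρ : Measure ℝ) →
        Integrable (fun x : ℝ => x ^ (2 * k)) (ρ : Measure ℝ) →
        Integrable (fun x : ℝ => ε * x ^ (2 * k) + s * x ^ k + 1 / (4 * ε)) (ρ : Measure ℝ) ∧
        ∫ x, (ε * x ^ (2 * k) + s * x ^ k + 1 / (4 * ε)) ∂(ρ : Measure ℝ) =
          ε * ∫ x, x ^ (2 * k) ∂(ρ : Measure ℝ) + s * ∫ x, x ^ k ∂(ρ : Measure ℝ) +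
            1 / (4 * ε) := by
      intro ρ h1 h2
      have h3 : Integrable (fun x : ℝ => ε * x ^ (2 * k) + s * x ^ k) (ρ : Measure ℝ) :=
        (h2.const_mul ε).add (h1.const_mul s)
      refine ⟨h3.add (integrable_const _), ?_⟩
      rw [integral_add h3 (integrable_const _), integral_add (h2.const_mul ε) (h1.const_mul s),
        integral_const_mul, integral_const_mul]
      simp
    have h := (hle (f := fun x : ℝ => ε * x ^ (2 * k) + s * x ^ k + 1 / (4 * ε)) (by fun_prop)
      (fun x => by
        have : ε * x ^ (2 * k) + s * x ^ k + 1 / (4 * ε) =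
          ε * (x ^ k + s / (2 * ε)) ^ 2 := by
          field_simp
          rw [mul_comm 2 k, pow_mul]
          linear_combination (-4) * hs
        change 0 ≤ ε * x ^ (2 * k) + s * x ^ k + 1 / (4 * ε)
        rw [this]
        positivity) (c := ε * a (2 * k) + s * a k + 1 / (4 * ε))
      (fun N => (hI (μ N) (hμ N k).1 (hμ N (2 * k)).1).1) (by
        refine ((((hm (2 * k)).const_mul ε).add ((hm k).const_mul s)).add_const _).congr
          fun N => ?_
        rw [(hI (μ N) (hμ N k).1 (hμ N (2 * k)).1).2, (hμ N k).2, (hμ N (2 * k)).2])).2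
    rw [(hI ν (hInt k) (heven k)).2] at h
    have h0 : 0 ≤ ∫ x, x ^ (2 * k) ∂(ν : Measure ℝ) :=
      integral_nonneg fun x => (even_two_mul k).pow_nonneg x
    nlinarith [mul_nonneg hε.le h0]
  have hlim : ∀ s : ℝ, s ^ 2 = 1 → s * (∫ x, x ^ k ∂(ν : Measure ℝ) - a k) ≤ 0 := by
    intro s hs
    refine ge_of_tendsto (f := fun ε : ℝ => ε * a (2 * k)) (x := 𝓝[>] 0) ?_ ?_
    · have : Tendsto (fun ε : ℝ => ε * a (2 * k)) (𝓝 0) (𝓝 (0 * a (2 * k))) :=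
        tendsto_id.mul_const _
      rw [zero_mul] at this
      exact this.mono_left nhdsWithin_le_nhds
    · filter_upwards [self_mem_nhdsWithin] with ε hε
      exact hkey s hs ε hε
  have h1 := hlim 1 (by norm_num)
  have h2 := hlim (-1) (by norm_num)
  linarith

/-- If the moments of a sequence of laws converge to a sequence with at most geometric growth, then
the laws converge weakly to a law with these moments. -/
lemma exists_tendsto_of_tendsto_moments {μ : ℕ → ProbabilityMeasure ℝ} {m : ℕ → ℕ → ℝ}
    (hμ : ∀ N, HasMoments (μ N) (m N)) {a : ℕ → ℝ} {C : ℝ} (hC : ∀ k, |a k| ≤ C ^ k)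
    (hm : ∀ k, Tendsto (fun N => m N k) atTop (𝓝 (a k))) :
    ∃ ν : ProbabilityMeasure ℝ, HasMoments ν a ∧ Tendsto μ atTop (𝓝 ν) := by
  obtain ⟨K, hK⟩ := (hm 2).bddAbove_range
  obtain ⟨ν, f, hf, hν⟩ := exists_subseq_tendsto_of_moments hμ fun N => hK ⟨N, rfl⟩
  have h := hasMoments_of_tendsto (fun N => hμ (f N)) hν
    fun k => (hm k).comp hf.tendsto_atTop
  -- The subsequence only produces `ν`; once its moments are known, the whole sequence converges.
  exact ⟨ν, h, tendsto_of_tendsto_moments hμ h hC hm⟩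

end MomentProblem

/-! ### Laws of self-adjoint elements of a C*-algebra. -/

section LawOfSelfAdjoint

/-- Both `φ ((1 + b) * (1 + b))` and `φ (b * b)` are real, and they differ by `1 + 2 φ b`. -/
lemma IsState.ofReal_re {A : Type*} [Ring A] [StarRing A] [Algebra ℂ A] {φ : A →ₗ[ℂ] ℂ}
    (hφ : IsState φ) {b : A} (hb : IsSelfAdjoint b) : ((φ b).re : ℂ) = φ b := by
  have h1 := hφ.nonneg (1 + b)
  have h2 := hφ.nonneg b
  rw [star_add, star_one, hb.star_eq] at h1
  rw [hb.star_eq] at h2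
  have h3 : (1 + b) * (1 + b) = 1 + (2 : ℂ) • b + b * b := by
    rw [two_smul]; noncomm_ring
  rw [h3, map_add, map_add, map_smul, hφ.map_one] at h1
  have e1 := (Complex.le_def.1 h1).2
  have e2 := (Complex.le_def.1 h2).2
  apply Complex.ext
  · simp
  · simp at e1 e2 ⊢
    linarith

variable {A : Type*} [CStarAlgebra A]

/-- A self-adjoint element of a unital C*-algebra has a law in every state. -/
lemma IsState.exists_hasMoments {φ : A →ₗ[ℂ] ℂ} (hφ : IsState φ) {a : A} (ha : IsSelfAdjoint a) :
    ∃ μ : ProbabilityMeasure ℝ, HasMoments μ (fun k => (φ (a ^ k)).re) ∧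
      ∀ k, |(φ (a ^ k)).re| ≤ ‖a‖ ^ k := by
  have hnt : Nontrivial A := by
    refine ⟨1, 0, fun h => ?_⟩
    have := hφ.map_one
    rw [h, map_zero] at this
    exact zero_ne_one this
  -- The law is the Riesz-Markov measure of `f ↦ φ (f(a))` on the compact spectrum. Positivity holds
  -- because a nonnegative `f` is the square of its root.
  let Λ₀ : CompactlySupportedContinuousMap (spectrum ℝ a) ℝ →ₗ[ℝ] ℝ :=
    { toFun := fun f => (φ (cfcHom (R := ℝ) ha f.toContinuousMap)).re
      map_add' := fun f g => by
        have : (f + g).toContinuousMap = f.toContinuousMap + g.toContinuousMap := rfl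
        rw [this, map_add, map_add, Complex.add_re]
      map_smul' := fun c f => by
        have : (c • f).toContinuousMap = c • f.toContinuousMap := rfl
        rw [this, map_smul, ← Complex.coe_smul, map_smul]
        simp }
  let Λ : CompactlySupportedContinuousMap (spectrum ℝ a) ℝ →ₚ[ℝ] ℝ :=
    PositiveLinearMap.mk₀ Λ₀ fun f hf => by
      let g : C(spectrum ℝ a, ℝ) := ⟨fun x => Real.sqrt (f x), by fun_prop⟩
      have hg : f.toContinuousMap = star g * g := by
        ext x
        have : (0 : ℝ) ≤ f x := hf x
        change f x = star (Real.sqrt (f x)) * Real.sqrt (f x)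
        rw [star_trivial, Real.mul_self_sqrt this]
      change 0 ≤ (φ (cfcHom (R := ℝ) ha f.toContinuousMap)).re
      rw [hg, map_mul, map_star]
      exact (Complex.le_def.1 (hφ.nonneg _)).1
  let ρ := RealRMK.rieszMeasure Λ
  have hρ : ∀ g : C(spectrum ℝ a, ℝ), ∫ x, g x ∂ρ = (φ (cfcHom (R := ℝ) ha g)).re := fun g =>
    RealRMK.integral_rieszMeasure Λ (CompactlySupportedContinuousMap.continuousMapEquiv g)
  have hfin : IsFiniteMeasure ρ := CompactSpace.isFiniteMeasure
  have hprob : IsProbabilityMeasure ρ := by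
    have h1 := hρ 1
    rw [_root_.map_one (cfcHom (R := ℝ) ha), hφ.map_one] at h1
    simp [Measure.real] at h1
    exact ⟨(ENNReal.toReal_eq_one_iff _).1 h1⟩
  have hpow : ∀ k : ℕ, ∫ x : spectrum ℝ a, (x : ℝ) ^ k ∂ρ = (φ (a ^ k)).re := by
    intro k
    have h1 := hρ (((ContinuousMap.id ℝ).restrict (spectrum ℝ a)) ^ k)
    rw [map_pow, cfcHom_id ha] at h1
    simpa using h1
  have hle : ∀ (k : ℕ) (x : spectrum ℝ a), ‖(x : ℝ) ^ k‖ ≤ ‖a‖ ^ k := by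
    intro k x
    rw [norm_pow]
    gcongr
    exact spectrum.norm_le_norm_of_mem x.2
  have hInt : ∀ k : ℕ, Integrable (fun x : spectrum ℝ a => (x : ℝ) ^ k) ρ := fun k =>
    (integrable_const (‖a‖ ^ k)).mono' (by fun_prop) (Eventually.of_forall (hle k))
  refine ⟨⟨ρ.map Subtype.val, Measure.isProbabilityMeasure_map (by fun_prop)⟩, fun k => ⟨?_, ?_⟩,
    fun k => ?_⟩
  · exact (integrable_map_measure (by fun_prop) (by fun_prop)).2 (hInt k)
  · exact (integral_map (by fun_prop) (by fun_prop)).trans (hpow k)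
  · rw [← hpow k]
    have := norm_integral_le_of_norm_le_const (μ := ρ) (Eventually.of_forall (hle k))
    simpa using this

lemma hasDistribution_iff_hasMoments {B : Type*} [Ring B] [Algebra ℂ B] {φ : B →ₗ[ℂ] ℂ} {a : B}
    {m : ℕ → ℝ} (h : ∀ k, φ (a ^ k) = m k) {μ : ProbabilityMeasure ℝ} :
    HasDistribution φ a μ ↔ HasMoments μ m := by
  refine forall_congr' fun k => and_congr_right fun _ => ?_
  rw [h k, Complex.ofReal_inj, eq_comm]

end LawOfSelfAdjoint

/-! ### Moments of sums from the peeling rule. -/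

section SumOfMonotone

lemma exists_list_map_eq {A ι : Type*} {X : ι → A} {t : Set ι} (l : List A)
    (hl : ∀ a ∈ l, a ∈ Set.image X t) :
    ∃ u : List ι, (∀ j ∈ u, j ∈ t) ∧ u.map X = l := by
  induction l with
  | nil => exact ⟨[], by simp, rfl⟩
  | cons a l ih =>
    obtain ⟨u, hu, rfl⟩ := ih fun b hb => hl b (List.mem_cons_of_mem _ hb)
    obtain ⟨j, hj, rfl⟩ := hl a List.mem_cons_self
    exact ⟨j :: u, by simpa using ⟨hj, hu⟩, rfl⟩

lemma eq_of_mem_adjoin_of_words {A ι : Type*} [Ring A] [Algebra ℂ A] {X : ι → A}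
    {t : Set ι} {f g : A →ₗ[ℂ] ℂ}
    (h : ∀ u : List ι, (∀ j ∈ u, j ∈ t) → f (u.map X).prod = g (u.map X).prod) {a : A}
    (ha : a ∈ Algebra.adjoin ℂ (Set.image X t)) : f a = g a := by
  rw [← Subalgebra.mem_toSubmodule, Algebra.adjoin_eq_span] at ha
  refine LinearMap.eqOn_span (fun b hb => ?_) ha
  obtain ⟨l, hl, rfl⟩ := Submonoid.exists_list_of_mem_closure hb
  obtain ⟨u, hu, rfl⟩ := exists_list_map_eq l hl
  exact h u hu

lemma sum_mem_adjoin {A ι : Type*} [Ring A] [Algebra ℂ A] {X : ι → A} {t : Set ι}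
    {s : Finset ι} (hs : ∀ j ∈ s, j ∈ t) :
    ∑ j ∈ s, X j ∈ Algebra.adjoin ℂ (Set.image X t) :=
  Subalgebra.sum_mem _ fun j hj => Algebra.subset_adjoin ⟨j, hs j hj, rfl⟩

variable {A ι : Type*} [Ring A] [Algebra ℂ A] [LinearOrder ι]

/-- In every word in the variables, a power of a variable whose neighbours have lower indices
factors out. -/
def PeelRule (φ : A →ₗ[ℂ] ℂ) (X : ι → A) (m : ℕ → ℝ) : Prop :=
  ∀ (u v : List ι) (i : ι) (k : ℕ), (∀ j ∈ u.getLast?, j < i) → (∀ j ∈ v.head?, j < i) →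
    φ ((u.map X).prod * X i ^ k * (v.map X).prod) = m k * φ ((u.map X).prod * (v.map X).prod)

variable {φ : A →ₗ[ℂ] ℂ} {X : ι → A} {m : ℕ → ℝ}

lemma PeelRule.apply_mul_pow (h : PeelRule φ X m) {s : Finset ι} {i : ι} (hs : ∀ j ∈ s, j < i)
    {U : A} (hU : U ∈ Algebra.adjoin ℂ (Set.image X s)) (k : ℕ) :
    φ (U * X i ^ k) = m k * φ U := by
  refine eq_of_mem_adjoin_of_words (X := X) (t := s) (f := φ ∘ₗ LinearMap.mulRight ℂ (X i ^ k))
    (g := (m k : ℂ) • φ) (fun u hu => ?_) hU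
  have := h u [] i k (fun j hj => hs j (hu j (List.mem_of_getLast? hj))) (by simp)
  simpa using this

/-- Only the letter right after `X i ^ k` has to be lower; the factor `∑ j ∈ s, X j` supplies it, so
`Z` may contain any variable. -/
lemma PeelRule.apply_mul_pow_mul (h : PeelRule φ X m) {s : Finset ι} {i : ι}
    (hs : ∀ j ∈ s, j < i) {U Z : A} (hU : U ∈ Algebra.adjoin ℂ (Set.image X s))
    (hZ : Z ∈ Algebra.adjoin ℂ (Set.image X Set.univ)) (k : ℕ) :
    φ (U * (X i ^ k * ((∑ j ∈ s, X j) * Z))) = m k * φ (U * ((∑ j ∈ s, X j) * Z)) := by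
  refine eq_of_mem_adjoin_of_words (X := X) (t := s)
    (f := φ ∘ₗ LinearMap.mulRight ℂ (X i ^ k * ((∑ j ∈ s, X j) * Z)))
    (g := (m k : ℂ) • φ ∘ₗ LinearMap.mulRight ℂ ((∑ j ∈ s, X j) * Z)) (fun u hu => ?_) hU
  have key := eq_of_mem_adjoin_of_words (X := X) (t := Set.univ)
    (f := φ ∘ₗ LinearMap.mulLeft ℂ ((u.map X).prod * (X i ^ k * (∑ j ∈ s, X j))))
    (g := (m k : ℂ) • φ ∘ₗ LinearMap.mulLeft ℂ ((u.map X).prod * (∑ j ∈ s, X j)))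
    (fun v _ => ?_) hZ
  · simpa [mul_assoc] using key
  · simp only [LinearMap.comp_apply, LinearMap.mulLeft_apply, LinearMap.smul_apply, smul_eq_mul,
      Finset.mul_sum, Finset.sum_mul, map_sum]
    refine Finset.sum_congr rfl fun j hj => ?_
    have := h u (j :: v) i k (fun j hj => hs j (hu j (List.mem_of_getLast? hj)))
      (by simpa using hs j hj)
    simpa [mul_assoc] using this

/-- Words in `S` and `x` are sorted by the length of their initial run of `x`. -/
lemma add_pow_succ_eq_sum {A : Type*} [Ring A] (S x : A) (n : ℕ) :
    (S + x) ^ (n + 1) = x ^ (n + 1) +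
      ∑ p ∈ Finset.HasAntidiagonal.antidiagonal n, x ^ p.1 * (S * (S + x) ^ p.2) := by
  induction n with
  | zero => simp [add_comm]
  | succ n ih =>
    rw [pow_succ' _ (n + 1), add_mul, Finset.Nat.sum_antidiagonal_succ]
    nth_rewrite 2 [ih]
    rw [mul_add, Finset.mul_sum]
    simp only [pow_zero, one_mul, pow_succ' x, mul_assoc]
    abel

lemma PeelRule.apply_add_pow (h : PeelRule φ X m) {s : Finset ι} {i : ι}
    (hs : ∀ j ∈ s, j < i) (n : ℕ) :
    φ ((∑ j ∈ s, X j + X i) ^ n) = ∑ p ∈ Finset.range (n + 1), φ ((∑ j ∈ s, X j) ^ p) *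
      (PowerSeries.coeff n (PowerSeries.X ^ p * PowerSeries.mk m ^ (p + 1)) : ℝ) := by
  set S := ∑ j ∈ s, X j with hS
  have hSmem : ∀ p : ℕ, S ^ p ∈ Algebra.adjoin ℂ (Set.image X (s : Set ι)) := fun p =>
    Subalgebra.pow_mem _ (sum_mem_adjoin fun j hj => hj) p
  have hZmem : ∀ p : ℕ, (S + X i) ^ p ∈ Algebra.adjoin ℂ (Set.image X Set.univ) := fun p =>
    Subalgebra.pow_mem _ (Subalgebra.add_mem _ (sum_mem_adjoin fun j _ => Set.mem_univ j)
      (Algebra.subset_adjoin ⟨i, Set.mem_univ i, rfl⟩)) p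
  let M : PowerSeries ℂ := PowerSeries.map (algebraMap ℝ ℂ) (PowerSeries.mk m)
  let G : ℕ → PowerSeries ℂ := fun q => PowerSeries.mk fun n => φ (S ^ q * (S + X i) ^ n)
  -- Peeling the leading run of `X i` contributes the factor `M`; what follows is empty or begins
  -- with `S`, which raises `q`. After `n + 1` iterations the remainder is divisible by `X ^ (n +
  -- 1)`, hence invisible to the `n`-th coefficient.
  have hG : ∀ q, G q = PowerSeries.C (φ (S ^ q)) * M + PowerSeries.X * M * G (q + 1) := by
    intro q
    ext n
    rw [map_add, PowerSeries.coeff_C_mul, mul_assoc]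
    rcases n with _ | n
    · have := h.apply_mul_pow hs (hSmem q) 0
      simp only [pow_zero, mul_one] at this
      rw [PowerSeries.coeff_zero_X_mul]
      simp [G, M, mul_comm, ← this]
    · rw [PowerSeries.coeff_succ_X_mul, PowerSeries.coeff_mul]
      simp only [G, M, PowerSeries.coeff_mk, PowerSeries.coeff_map]
      rw [add_pow_succ_eq_sum, mul_add, map_add, h.apply_mul_pow hs (hSmem q), Finset.mul_sum,
        map_sum, mul_comm]
      congr 1
      refine Finset.sum_congr rfl fun p _ => ?_
      rw [h.apply_mul_pow_mul hs (hSmem q) (hZmem _), pow_succ, mul_assoc]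
      rfl
  have hiter : ∀ p, G 0 = (∑ q ∈ Finset.range p,
      PowerSeries.C (φ (S ^ q)) * (PowerSeries.X ^ q * M ^ (q + 1))) +
        PowerSeries.X ^ p * (M ^ p * G p) := by
    intro p
    induction p with
    | zero => simp
    | succ p ih =>
      rw [ih, Finset.sum_range_succ, hG p]
      ring
  have h0 : φ ((S + X i) ^ n) = PowerSeries.coeff n (G 0) := by simp [G]
  rw [h0, hiter (n + 1), map_add, map_sum, PowerSeries.coeff_X_pow_mul', if_neg (by omega),
    add_zero]
  refine Finset.sum_congr rfl fun p _ => ?_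
  rw [PowerSeries.coeff_C_mul]
  congr 1
  have : PowerSeries.X ^ p * M ^ (p + 1) = PowerSeries.map (algebraMap ℝ ℂ)
      (PowerSeries.X ^ p * PowerSeries.mk m ^ (p + 1)) := by simp [M]
  rw [this, PowerSeries.coeff_map]
  rfl

/-- The moments of a sum of identically distributed monotone independent variables. -/
lemma PeelRule.apply_sum_pow (h : PeelRule φ X m) (h1 : φ 1 = 1) (s : Finset ι) (n : ℕ) :
    φ ((∑ j ∈ s, X j) ^ n) =
      (PowerSeries.coeff n (monotoneIter (PowerSeries.mk m) s.card) : ℝ) := by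
  induction s using Finset.induction_on_max generalizing n with
  | empty =>
    rcases n with _ | n
    · simp [monotoneIter, h1]
    · simp [monotoneIter, PowerSeries.coeff_one]
  | insert i s hs ih =>
    have hi : i ∉ s := fun hi => lt_irrefl _ (hs i hi)
    rw [Finset.sum_insert hi, add_comm, h.apply_add_pow hs, Finset.card_insert_of_notMem hi,
      monotoneIter, monotoneConv, PowerSeries.coeff_mk]
    push_cast
    exact Finset.sum_congr rfl fun p _ => by rw [ih]

end SumOfMonotone

/-! ### From monotone independence to the peeling rule; scalar powers. -/

section PeelRuleOfIndep

/-- Every list is the concatenation of its maximal constant runs. -/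
lemma exists_runs {ι : Type*} (u : List ι) :
    ∃ w : List (ι × ℕ), (∀ p ∈ w, 1 ≤ p.2) ∧ (w.map Prod.fst).IsChain (· ≠ ·) ∧
      u = w.flatMap fun p => List.replicate p.2 p.1 := by
  classical
  induction u with
  | nil => exact ⟨[], by simp, by simp, rfl⟩
  | cons a u ih =>
    obtain ⟨w, h1, h2, h3⟩ := ih
    rcases w with _ | ⟨⟨b, k⟩, w⟩
    · exact ⟨[(a, 1)], by simp, by simp, by simp [h3]⟩
    · by_cases hab : a = b
      · subst hab
        refine ⟨(a, k + 1) :: w, ?_, h2, ?_⟩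
        · intro p hp
          rcases List.mem_cons.1 hp with rfl | hp
          · simp
          · exact h1 p (List.mem_cons_of_mem _ hp)
        · simp [h3, List.replicate_succ]
      · refine ⟨(a, 1) :: (b, k) :: w, ?_, ?_, ?_⟩
        · intro p hp
          rcases List.mem_cons.1 hp with rfl | hp
          · simp
          · exact h1 p hp
        · exact List.IsChain.cons_cons hab h2
        · simp [h3]

lemma head?_of_runs {ι : Type*} {w : List (ι × ℕ)} (h : ∀ p ∈ w, 1 ≤ p.2) :
    (w.flatMap fun p => List.replicate p.2 p.1).head? = (w.map Prod.fst).head? := by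
  rcases w with _ | ⟨⟨b, k⟩, w⟩
  · rfl
  · obtain ⟨k, rfl⟩ : ∃ q, k = q + 1 := ⟨k - 1, by have := h (b, k) (by simp); simp at this; omega⟩
    simp [List.replicate_succ]

lemma getLast?_of_runs {ι : Type*} {w : List (ι × ℕ)} (h : ∀ p ∈ w, 1 ≤ p.2) :
    (w.flatMap fun p => List.replicate p.2 p.1).getLast? = (w.map Prod.fst).getLast? := by
  induction w using List.reverseRecOn with
  | nil => rfl
  | append_singleton w p _ =>
    obtain ⟨b, k⟩ := p
    obtain ⟨k, rfl⟩ : ∃ q, k = q + 1 := ⟨k - 1, by have := h (b, k) (by simp); simp at this; omega⟩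
    simp [List.replicate_succ']

lemma prod_map_of_runs {ι A : Type*} [Monoid A] (X : ι → A) (w : List (ι × ℕ)) :
    ((w.flatMap fun p => List.replicate p.2 p.1).map X).prod =
      (w.map fun p => X p.1 ^ p.2).prod := by
  induction w with
  | nil => rfl
  | cons p w ih => simp [ih]

lemma apply_pow_of_eq_algebraMap {A : Type*} [Ring A] [Algebra ℂ A] {φ : A →ₗ[ℂ] ℂ}
    (h1 : φ 1 = 1) {a : A} {c : ℂ} (h : a = algebraMap ℂ A c) (k : ℕ) : φ (a ^ k) = c ^ k := by
  rw [h, ← map_pow, Algebra.algebraMap_eq_smul_one, map_smul, h1, smul_eq_mul, mul_one]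

lemma notMem_range_of_moments {A ι : Type*} [Ring A] [Algebra ℂ A] {φ : A →ₗ[ℂ] ℂ} {X : ι → A}
    {m : ℕ → ℝ} (h1 : φ 1 = 1) (hm : ∀ i k, φ (X i ^ k) = m k)
    (h2 : m 2 ≠ m 1 ^ 2) (i : ι) : X i ∉ Set.range (algebraMap ℂ A) := by
  rintro ⟨c, hc⟩
  have e1 := hm i 1
  have e2 := hm i 2
  rw [apply_pow_of_eq_algebraMap h1 hc.symm] at e1 e2
  rw [pow_one] at e1
  rw [e1] at e2
  exact h2 (by exact_mod_cast e2.symm)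

variable {A ι : Type*} [Ring A] [StarRing A] [Algebra ℂ A] [StarModule ℂ A] [LinearOrder ι]
  {φ : A →ₗ[ℂ] ℂ} {X : ι → A} {m : ℕ → ℝ}

lemma apply_mul_of_monotoneIndep (hind : MonotoneIndep φ X) {i j : ι} (hij : i ≠ j) {a b : A}
    (ha : a ∈ NonUnitalStarAlgebra.adjoin ℂ {X i}) (hb : b ∈ NonUnitalStarAlgebra.adjoin ℂ {X j})
    (ha' : a ∉ Set.range (algebraMap ℂ A)) (hb' : b ∉ Set.range (algebraMap ℂ A)) :
    φ (a * b) = φ a * φ b := by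
  rcases hij.lt_or_gt with h | h
  · have := hind [(i, a)] [] j b (by simp [-Set.mem_range, ha, hb, ha', hb'])
      (by simpa using hij) (by simpa using h) (by simp)
    simpa [mul_comm] using this
  · have := hind [] [(j, b)] i a (by simp [-Set.mem_range, ha, hb, ha', hb'])
      (by simpa using hij) (by simp) (by simpa using h)
    simpa using this

lemma self_mem_nonUnitalAdjoin (a : A) : a ∈ NonUnitalStarAlgebra.adjoin ℂ {a} :=
  NonUnitalStarAlgebra.subset_adjoin ℂ {a} rfl

lemma pow_mem_nonUnitalAdjoin (a : A) {k : ℕ} (hk : 1 ≤ k) :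
    a ^ k ∈ NonUnitalStarAlgebra.adjoin ℂ {a} := by
  induction k, hk using Nat.le_induction with
  | base => rw [pow_one]; exact self_mem_nonUnitalAdjoin a
  | succ k _ ih => rw [pow_succ]; exact mul_mem ih (self_mem_nonUnitalAdjoin a)

/-- For monotone independent variables with a common nondegenerate law, a nonzero power of a
variable can be a scalar only if the index of the variable is maximal. -/
lemma not_lt_of_pow_eq_algebraMap (hind : MonotoneIndep φ X) (h1 : φ 1 = 1)
    (hm : ∀ i k, φ (X i ^ k) = m k) (h2 : m 2 ≠ m 1 ^ 2) {i j : ι} {k : ℕ} (hk : 1 ≤ k) {c : ℂ}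
    (hc : X i ^ k = algebraMap ℂ A c) (hc0 : c ≠ 0) : ¬ i < j := by
  intro hij
  have hsc := notMem_range_of_moments h1 hm h2
  have hone : (1 : A) ∈ NonUnitalStarAlgebra.adjoin ℂ {X i} := by
    have h := SMulMemClass.smul_mem c⁻¹ (pow_mem_nonUnitalAdjoin (X i) hk)
    rwa [hc, Algebra.algebraMap_eq_smul_one, smul_smul, inv_mul_cancel₀ hc0, one_smul] at h
  -- Now `1` lies in the algebra of `X i`. Comparing this identity for `y = X i` and `y = X i + 1`
  -- forces `φ (X j ^ 2) = m 1 ^ 2`, contradicting nondegeneracy.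
  have hkey : ∀ y ∈ NonUnitalStarAlgebra.adjoin ℂ {X i}, y ∉ Set.range (algebraMap ℂ A) →
      φ (X j * (y * X j)) = m 1 * (φ y * m 1) := by
    intro y hy hy'
    have hxj := self_mem_nonUnitalAdjoin (X j)
    have e1 := hind [] [(i, y), (j, X j)] j (X j)
      (by simp [-Set.mem_range, hy, hy', hxj, hsc j])
      (by simp [hij.ne, hij.ne']) (by simp) (by simpa using hij)
    have e2 := apply_mul_of_monotoneIndep hind hij.ne hy hxj hy' (hsc j)
    have e3 := hm j 1
    rw [pow_one] at e3
    simpa [e2, e3] using e1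
  have k1 := hkey (X i) (self_mem_nonUnitalAdjoin _) (hsc i)
  have k2 := hkey (X i + 1) (add_mem (self_mem_nonUnitalAdjoin _) hone) (by
    rintro ⟨b, hb⟩
    exact hsc i ⟨b - 1, by rw [map_sub, hb, map_one, add_sub_cancel_right]⟩)
  rw [add_mul, mul_add, map_add, k1, one_mul, ← sq, hm, map_add, h1] at k2
  refine h2 ?_
  have k3 : (m 2 : ℂ) = m 1 ^ 2 := by linear_combination k2
  exact_mod_cast k3

lemma apply_of_nonscalar_runs (hind : MonotoneIndep φ X) {w z : List (ι × ℕ)} {i : ι} {k : ℕ}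
    (hw : ∀ p ∈ w ++ (i, k) :: z, 1 ≤ p.2 ∧ X p.1 ^ p.2 ∉ Set.range (algebraMap ℂ A))
    (hwc : (w.map Prod.fst).IsChain (· ≠ ·)) (hzc : (z.map Prod.fst).IsChain (· ≠ ·))
    (hwl : ∀ j ∈ (w.map Prod.fst).getLast?, j < i) (hzh : ∀ j ∈ (z.map Prod.fst).head?, j < i) :
    φ ((w.map fun p => X p.1 ^ p.2).prod * X i ^ k * (z.map fun p => X p.1 ^ p.2).prod) =
      φ (X i ^ k) * φ ((w.map fun p => X p.1 ^ p.2).prod * (z.map fun p => X p.1 ^ p.2).prod) := by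
  let f : ι × ℕ → ι × A := fun p => (p.1, X p.1 ^ p.2)
  have hfst : ∀ l : List (ι × ℕ), (l.map f).map Prod.fst = l.map Prod.fst := fun l => by
    simp [f, Function.comp_def]
  have hsnd : ∀ l : List (ι × ℕ), (l.map f).map Prod.snd = l.map fun p => X p.1 ^ p.2 :=
    fun l => by simp [f, Function.comp_def]
  have happ : w.map f ++ (i, X i ^ k) :: z.map f = (w ++ (i, k) :: z).map f := by simp [f]
  have h := hind (w.map f) (z.map f) i (X i ^ k) ?_ ?_ ?_ ?_
  · rw [happ, ← List.map_append, hsnd, hsnd] at h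
    simpa [mul_assoc] using h
  · rw [happ]
    intro p hp
    obtain ⟨q, hq, rfl⟩ := List.mem_map.1 hp
    exact ⟨pow_mem_nonUnitalAdjoin _ (hw q hq).1, (hw q hq).2⟩
  · rw [happ, hfst, List.map_append, List.map_cons, List.isChain_append]
    refine ⟨hwc, ?_, ?_⟩
    · rw [List.isChain_cons]
      exact ⟨fun j hj => (hzh j hj).ne', hzc⟩
    · intro x hx y hy
      obtain rfl : i = y := by simpa using hy
      exact (hwl x hx).ne
  · intro p hp
    refine hwl p.1 ?_
    rw [← hfst, List.getLast?_map, Option.mem_map]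
    exact ⟨p, hp, rfl⟩
  · intro p hp
    refine hzh p.1 ?_
    rw [← hfst, List.head?_map, Option.mem_map]
    exact ⟨p, hp, rfl⟩

/-- Scalar blocks are deleted from the word by induction on its length. A zero block kills both
sides. A nonzero one has maximal index, so it cannot be adjacent to `X i`, whose neighbours are
lower, and deleting it keeps those neighbours. Once no scalar block remains, the maximal runs are
admissible letters. -/
lemma peelRule_of_monotoneIndep (hind : MonotoneIndep φ X) (h1 : φ 1 = 1)
    (hm : ∀ i k, φ (X i ^ k) = m k) (h2 : m 2 ≠ m 1 ^ 2) : PeelRule φ X m := by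
  intro u v i k hu hv
  rcases Nat.eq_zero_or_pos k with rfl | hk
  · have := hm i 0
    rw [pow_zero, h1] at this
    rw [← this, pow_zero, mul_one, one_mul]
  induction hn : u.length + v.length using Nat.strong_induction_on generalizing u v with
  | _ n ih =>
  let E : List ι → Prop := fun u => ∃ (u₁ : List ι) (q : ℕ) (j : ι) (u₂ : List ι) (c : ℂ),
    1 ≤ q ∧ u = u₁ ++ (List.replicate q j ++ u₂) ∧ X j ^ q = algebraMap ℂ A c
  have hprod : ∀ (u₁ u₂ : List ι) (q : ℕ) (j : ι) (c : ℂ), X j ^ q = algebraMap ℂ A c →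
      ((u₁ ++ (List.replicate q j ++ u₂)).map X).prod = c • ((u₁ ++ u₂).map X).prod := by
    intro u₁ u₂ q j c hc
    simp [hc, Algebra.algebraMap_eq_smul_one]
  by_cases hEu : E u
  · obtain ⟨u₁, q, j, u₂, c, hq, rfl, hc⟩ := hEu
    rw [hprod _ _ _ _ _ hc]
    rcases eq_or_ne c 0 with rfl | hc0
    · simp
    have hmax := fun j' => not_lt_of_pow_eq_algebraMap (j := j') hind h1 hm h2 hq hc hc0
    -- If the block ended `u`, its index would be a neighbour of `i`, hence smaller than `i`.
    have hu2 : u₂ ≠ [] := by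
      rintro rfl
      refine hmax i (hu j ?_)
      obtain ⟨q, rfl⟩ : ∃ p, q = p + 1 := ⟨q - 1, by omega⟩
      simp [List.replicate_succ']
    have hlast : ∀ l : List ι, (l ++ u₂).getLast? = u₂.getLast? := fun l =>
      List.getLast?_append_of_ne_nil l hu2
    have := ih _ (by rw [← hn]; simp; omega) (u₁ ++ u₂) v
      (by rw [hlast]; rwa [← List.append_assoc, hlast] at hu) hv rfl
    simp only [smul_mul_assoc, map_smul, this, smul_eq_mul]
    ring
  by_cases hEv : E v
  · obtain ⟨v₁, q, j, v₂, c, hq, rfl, hc⟩ := hEv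
    rw [hprod _ _ _ _ _ hc]
    rcases eq_or_ne c 0 with rfl | hc0
    · simp
    have hmax := fun j' => not_lt_of_pow_eq_algebraMap (j := j') hind h1 hm h2 hq hc hc0
    have hv1 : v₁ ≠ [] := by
      rintro rfl
      refine hmax i (hv j ?_)
      obtain ⟨q, rfl⟩ : ∃ p, q = p + 1 := ⟨q - 1, by omega⟩
      simp [List.replicate_succ]
    have hhead : ∀ l : List ι, (v₁ ++ l).head? = v₁.head? := fun l =>
      List.head?_append_of_ne_nil v₁ hv1
    have := ih _ (by rw [← hn]; simp; omega) u (v₁ ++ v₂) hu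
      (by rw [hhead]; rwa [hhead] at hv) rfl
    simp only [mul_smul_comm, map_smul, this, smul_eq_mul]
    ring
  by_cases hik : X i ^ k ∈ Set.range (algebraMap ℂ A)
  · obtain ⟨c, hc⟩ := hik
    have e := hm i k
    rw [← hc, Algebra.algebraMap_eq_smul_one, map_smul, h1, smul_eq_mul, mul_one] at e
    rw [← hc, ← e, Algebra.algebraMap_eq_smul_one]
    simp
  have hrun : ∀ w : List (ι × ℕ), (∀ p ∈ w, 1 ≤ p.2) →
      ¬ E (w.flatMap fun p => List.replicate p.2 p.1) →
      ∀ p ∈ w, 1 ≤ p.2 ∧ X p.1 ^ p.2 ∉ Set.range (algebraMap ℂ A) := by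
    intro w hw hE p hp
    refine ⟨hw p hp, ?_⟩
    rintro ⟨c, hc⟩
    obtain ⟨w₁, w₂, rfl⟩ := List.append_of_mem hp
    exact hE ⟨_, p.2, p.1, _, c, hw p hp, by rw [List.flatMap_append, List.flatMap_cons], hc.symm⟩
  obtain ⟨w, w1, w2, rfl⟩ := exists_runs u
  obtain ⟨z, z1, z2, rfl⟩ := exists_runs v
  rw [getLast?_of_runs w1] at hu
  rw [head?_of_runs z1] at hv
  rw [prod_map_of_runs, prod_map_of_runs, ← hm i k]
  refine apply_of_nonscalar_runs hind (fun p hp => ?_) w2 z2 hu hv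
  rcases List.mem_append.1 hp with hp | hp
  · exact hrun w w1 hEu p hp
  · rcases List.mem_cons.1 hp with rfl | hp
    · exact ⟨hk, hik⟩
    · exact hrun z z1 hEv p hp

end PeelRuleOfIndep

/-! ### Monotone independent operators on iterated L² spaces. -/

section HilbertModel

open ContinuousLinearMap (adjoint)
open scoped InnerProductSpace ENNReal

/-- Markov's inequality for `x ^ (2 * k)`, with `k → ∞`; the margin `1` makes the ratio `C / (C +
1)` less than one. -/
lemma HasMoments.ae_abs_le {μ : ProbabilityMeasure ℝ} {a : ℕ → ℝ} (h : HasMoments μ a) {C : ℝ}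
    (hC0 : 0 ≤ C) (hC : ∀ k, |a k| ≤ C ^ k) : ∀ᵐ x ∂(μ : Measure ℝ), |x| ≤ C + 1 := by
  have hle : ∀ k : ℕ, (μ : Measure ℝ).real {x | C + 1 < |x|} ≤ ((C / (C + 1)) ^ 2) ^ k := by
    intro k
    have h1 := mul_meas_ge_le_integral_of_nonneg (μ := (μ : Measure ℝ))
      (f := fun x : ℝ => x ^ (2 * k)) (Eventually.of_forall fun x => (even_two_mul k).pow_nonneg x)
      (h (2 * k)).1 ((C + 1) ^ (2 * k))
    rw [(h (2 * k)).2] at h1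
    have h2 : (μ : Measure ℝ).real {x | C + 1 < |x|} ≤
        (μ : Measure ℝ).real {x | (C + 1) ^ (2 * k) ≤ x ^ (2 * k)} := by
      refine measureReal_mono fun x hx => ?_
      change (C + 1) ^ (2 * k) ≤ x ^ (2 * k)
      rw [← (even_two_mul k).pow_abs x]
      exact pow_le_pow_left₀ (by positivity) (le_of_lt hx) _
    rw [← pow_mul, div_pow, le_div_iff₀ (by positivity)]
    calc _ ≤ (C + 1) ^ (2 * k) *
          (μ : Measure ℝ).real {x | (C + 1) ^ (2 * k) ≤ x ^ (2 * k)} := by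
          rw [mul_comm]; gcongr
      _ ≤ _ := h1.trans ((le_abs_self _).trans (hC _))
  have hlim : Tendsto (fun k : ℕ => ((C / (C + 1)) ^ 2) ^ k) atTop (𝓝 0) := by
    refine tendsto_pow_atTop_nhds_zero_of_lt_one (by positivity) ?_
    refine pow_lt_one₀ (by positivity) ?_ two_ne_zero
    rw [div_lt_one (by positivity)]
    linarith
  have h0 : (μ : Measure ℝ).real {x | C + 1 < |x|} = 0 :=
    le_antisymm (ge_of_tendsto' hlim hle) measureReal_nonneg
  rw [measureReal_eq_zero_iff] at h0
  rw [ae_iff]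
  simpa using h0

/-- Variables `Y i`, `i < N`, on a Hilbert space with a vacuum vector `Ω` and an increasing family
of projections `E i`, such that `Y i` lives on the range of `E (i + 1)` and its powers are scalar
when compressed to the range of `E i`. -/
structure IsMonotoneTower {H : Type} [NormedAddCommGroup H] [InnerProductSpace ℂ H]
    [CompleteSpace H] (m : ℕ → ℝ) (N : ℕ) (Ω : H) (E Y : ℕ → H →L[ℂ] H) : Prop where
  norm_vac : ‖Ω‖ = 1
  proj_vac : E 0 Ω = Ω
  proj_sa : ∀ i, IsSelfAdjoint (E i)
  proj_mul : ∀ i j, i ≤ j → E i * E j = E i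
  proj_top : E N = 1
  var_sa : ∀ i, IsSelfAdjoint (Y i)
  var_mul : ∀ i < N, Y i * E (i + 1) = Y i
  compress : ∀ i < N, ∀ k : ℕ, E i * Y i ^ k * E i = (m k : ℂ) • E i

lemma isMonotoneTower_zero (m : ℕ → ℝ) :
    IsMonotoneTower m 0 (1 : ℂ) (fun _ => 1) (fun _ => 0) where
  norm_vac := by simp
  proj_vac := rfl
  proj_sa _ := IsSelfAdjoint.one _
  proj_mul _ _ _ := one_mul _
  proj_top := rfl
  var_sa _ := IsSelfAdjoint.zero _
  var_mul _ h := absurd h (by omega)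
  compress _ h := absurd h (by omega)

section Step

variable {H H' : Type} [NormedAddCommGroup H] [InnerProductSpace ℂ H] [CompleteSpace H]
  [NormedAddCommGroup H'] [InnerProductSpace ℂ H'] [CompleteSpace H']

/-- The (non-unital) embedding of operators induced by `J`. -/
noncomputable def conjBy (J : H →L[ℂ] H') (T : H →L[ℂ] H) : H' →L[ℂ] H' :=
  J ∘L T ∘L adjoint J

lemma conjBy_mul {J : H →L[ℂ] H'} (hJ : adjoint J ∘L J = 1) (S T : H →L[ℂ] H) :
    conjBy J S * conjBy J T = conjBy J (S * T) := by
  ext v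
  have : ∀ w, adjoint J (J w) = w := fun w => congr($hJ w)
  simp [conjBy, this]

lemma isSelfAdjoint_conjBy (J : H →L[ℂ] H') {T : H →L[ℂ] H} (hT : IsSelfAdjoint T) :
    IsSelfAdjoint (conjBy J T) := by
  rw [ContinuousLinearMap.isSelfAdjoint_iff'] at hT ⊢
  rw [conjBy, ContinuousLinearMap.adjoint_comp, ContinuousLinearMap.adjoint_comp, hT,
    ContinuousLinearMap.adjoint_adjoint, ContinuousLinearMap.comp_assoc]

/-- Old operators are carried to the range of the isometry `J` and vanish on its complement, while
the new top variable `x` acts on all of `H'`. The compression of `x ^ k` to that range is scalar by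
`hxk`. -/
lemma IsMonotoneTower.succ {m : ℕ → ℝ} {N : ℕ} {Ω : H} {E Y : ℕ → H →L[ℂ] H}
    (h : IsMonotoneTower m N Ω E Y) (J : H →L[ℂ] H') (hJ : adjoint J ∘L J = 1)
    {x : H' →L[ℂ] H'} (hx : IsSelfAdjoint x)
    (hxk : ∀ k : ℕ, adjoint J ∘L (x ^ k) ∘L J = (m k : ℂ) • 1) :
    IsMonotoneTower m (N + 1) (J Ω) (fun i => if i ≤ N then conjBy J (E i) else 1)
      (fun i => if i < N then conjBy J (Y i) else x) where
  norm_vac := by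
    have h1 : ⟪J Ω, J Ω⟫_ℂ = ⟪Ω, Ω⟫_ℂ := by
      rw [← ContinuousLinearMap.adjoint_inner_left]
      exact congr(⟪$hJ Ω, Ω⟫_ℂ)
    rw [inner_self_eq_norm_sq_to_K, inner_self_eq_norm_sq_to_K] at h1
    have h2 : ‖J Ω‖ ^ 2 = ‖Ω‖ ^ 2 := by exact_mod_cast h1
    rw [h.norm_vac, one_pow] at h2
    exact (pow_eq_one_iff_of_nonneg (norm_nonneg _) two_ne_zero).1 h2
  proj_vac := by
    have : adjoint J (J Ω) = Ω := congr($hJ Ω)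
    simp [conjBy, this, h.proj_vac]
  proj_sa i := by
    split_ifs
    · exact isSelfAdjoint_conjBy J (h.proj_sa i)
    · exact IsSelfAdjoint.one _
  proj_mul i j hij := by
    by_cases hj : j ≤ N
    · simp only [if_pos hj, if_pos (hij.trans hj)]
      rw [conjBy_mul hJ, h.proj_mul i j hij]
    · simp only [if_neg hj]
      exact mul_one _
  proj_top := by simp
  var_sa i := by
    split_ifs
    · exact isSelfAdjoint_conjBy J (h.var_sa i)
    · exact hx
  var_mul i hi := by
    by_cases hiN : i < N
    · simp only [if_pos hiN, if_pos (show i + 1 ≤ N from hiN)]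
      rw [conjBy_mul hJ, h.var_mul i hiN]
    · simp only [if_neg hiN, if_neg (show ¬ i + 1 ≤ N from hiN)]
      exact mul_one _
  compress i hi k := by
    by_cases hiN : i < N
    · simp only [if_pos hiN, if_pos hiN.le]
      have hpow : conjBy J (E i) * conjBy J (Y i) ^ k = conjBy J (E i * Y i ^ k) := by
        induction k with
        | zero => simp
        | succ k ih => rw [pow_succ, ← mul_assoc, ih, conjBy_mul hJ, pow_succ, mul_assoc]
      rw [hpow, conjBy_mul hJ, h.compress i hiN k]
      ext v
      simp [conjBy]
    · obtain rfl : i = N := by omega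
      simp only [lt_irrefl, if_false, le_refl, if_true, h.proj_top]
      ext v
      have : adjoint J ((x ^ k) (J (adjoint J v))) = (m k : ℂ) • adjoint J v :=
        congr($(hxk k) (adjoint J v))
      change J (adjoint J ((x ^ k) (J (adjoint J v)))) = (m k : ℂ) • J (adjoint J v)
      rw [this, map_smul]

end Step

section MultiplicationOperator

variable {H : Type} [NormedAddCommGroup H] [InnerProductSpace ℂ H] [CompleteSpace H]

lemma adjoint_constL_comp_constL (μ : Measure ℝ) [IsProbabilityMeasure μ] :
    adjoint (Lp.constL 2 μ ℂ : H →L[ℂ] Lp H 2 μ) ∘L Lp.constL 2 μ ℂ = 1 := by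
  ext v
  refine ext_inner_left ℂ fun w => ?_
  rw [ContinuousLinearMap.comp_apply, ContinuousLinearMap.adjoint_inner_right, L2.inner_def]
  have : ∀ᵐ x ∂μ, ⟪(Lp.constL 2 μ ℂ w : Lp H 2 μ) x, (Lp.constL 2 μ ℂ v : Lp H 2 μ) x⟫_ℂ =
      ⟪w, v⟫_ℂ := by
    filter_upwards [Lp.coeFn_const (p := 2) (μ := μ) w, Lp.coeFn_const (p := 2) (μ := μ) v]
      with x h1 h2
    exact congr(⟪$h1, $h2⟫_ℂ)
  rw [integral_congr_ae this]
  simp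

lemma exists_mulOperator {H : Type} [NormedAddCommGroup H] [InnerProductSpace ℂ H]
    (μ : Measure ℝ) [IsProbabilityMeasure μ] {R : ℝ}
    (hR : ∀ᵐ x ∂μ, |x| ≤ R) :
    ∃ x : Lp H 2 μ →L[ℂ] Lp H 2 μ, ∀ g : Lp H 2 μ, x g =ᵐ[μ] fun t => (t : ℂ) • g t := by
  have hmem : MemLp (fun t : ℝ => (t : ℂ)) ∞ μ :=
    memLp_top_of_bound (by fun_prop) R (by simpa using hR)
  refine ⟨(ContinuousLinearMap.lsmul ℂ ℂ).holderL μ ∞ 2 2 hmem.toLp, fun g => ?_⟩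
  rw [ContinuousLinearMap.holderL_apply_apply]
  filter_upwards [ContinuousLinearMap.coeFn_holder (r := 2) (ContinuousLinearMap.lsmul ℂ ℂ)
    hmem.toLp g, hmem.coeFn_toLp] with t h1 h2
  rw [h1, h2]
  rfl

lemma isSelfAdjoint_of_mulOperator {μ : Measure ℝ} {x : Lp H 2 μ →L[ℂ] Lp H 2 μ}
    (hx : ∀ g : Lp H 2 μ, x g =ᵐ[μ] fun t => (t : ℂ) • g t) : IsSelfAdjoint x := by
  rw [ContinuousLinearMap.isSelfAdjoint_iff_isSymmetric]
  intro f g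
  change ⟪x f, g⟫_ℂ = ⟪f, x g⟫_ℂ
  rw [L2.inner_def, L2.inner_def]
  refine integral_congr_ae ?_
  filter_upwards [hx f, hx g] with t h1 h2
  rw [h1, h2, inner_smul_left, inner_smul_right, Complex.conj_ofReal]

lemma adjoint_constL_comp_pow_comp_constL {ν : ProbabilityMeasure ℝ} {m : ℕ → ℝ}
    (h : HasMoments ν m) {x : Lp H 2 (ν : Measure ℝ) →L[ℂ] Lp H 2 (ν : Measure ℝ)}
    (hx : ∀ g : Lp H 2 (ν : Measure ℝ), x g =ᵐ[(ν : Measure ℝ)] fun t => (t : ℂ) • g t) (k : ℕ) :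
    adjoint (Lp.constL 2 (ν : Measure ℝ) ℂ : H →L[ℂ] Lp H 2 (ν : Measure ℝ)) ∘L (x ^ k) ∘L
      Lp.constL 2 (ν : Measure ℝ) ℂ = (m k : ℂ) • 1 := by
  have hpow : ∀ v : H, (x ^ k) (Lp.constL 2 (ν : Measure ℝ) ℂ v) =ᵐ[(ν : Measure ℝ)]
      fun t => ((t ^ k : ℝ) : ℂ) • v := by
    intro v
    induction k with
    | zero =>
      filter_upwards with t
      simp
    | succ k ih =>
      rw [pow_succ', mul_apply_eq_comp]
      filter_upwards [hx ((x ^ k) (Lp.constL 2 (ν : Measure ℝ) ℂ v)), ih] with t h1 h2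
      rw [h1, h2, smul_smul, pow_succ']
      push_cast
      rfl
  ext v
  refine ext_inner_left ℂ fun w => ?_
  rw [ContinuousLinearMap.comp_apply, ContinuousLinearMap.adjoint_inner_right, L2.inner_def]
  have : ∀ᵐ t ∂(ν : Measure ℝ), ⟪(Lp.constL 2 (ν : Measure ℝ) ℂ w : Lp H 2 (ν : Measure ℝ)) t,
      (((x ^ k) ∘L Lp.constL 2 (ν : Measure ℝ) ℂ) v : Lp H 2 (ν : Measure ℝ)) t⟫_ℂ =
      ((t ^ k : ℝ) : ℂ) * ⟪w, v⟫_ℂ := by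
    filter_upwards [Lp.coeFn_const (p := 2) (μ := (ν : Measure ℝ)) w, hpow v] with t h1 h2
    rw [← inner_smul_right]
    exact congr(⟪$h1, $h2⟫_ℂ)
  rw [integral_congr_ae this, integral_mul_const, integral_complex_ofReal, (h k).2]
  simp

end MultiplicationOperator

/-- Starting from `ℂ`, each step passes from `H` to `L²(ν; H)`: `J` embeds `H` as constant functions
and `x` multiplies by the coordinate, which is bounded because `ν` has bounded support. -/
lemma exists_isMonotoneTower {ν : ProbabilityMeasure ℝ} {m : ℕ → ℝ} (h : HasMoments ν m) {R : ℝ}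
    (hR : ∀ᵐ x ∂(ν : Measure ℝ), |x| ≤ R) (N : ℕ) :
    ∃ (H : Type) (_ : NormedAddCommGroup H) (_ : InnerProductSpace ℂ H) (_ : CompleteSpace H)
      (Ω : H) (E Y : ℕ → H →L[ℂ] H), IsMonotoneTower m N Ω E Y := by
  induction N with
  | zero => exact ⟨ℂ, inferInstance, inferInstance, inferInstance, _, _, _, isMonotoneTower_zero m⟩
  | succ N ih =>
    obtain ⟨H, _, _, _, Ω, E, Y, hT⟩ := ih
    obtain ⟨x, hx⟩ := exists_mulOperator (H := H) (ν : Measure ℝ) hR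
    exact ⟨Lp H 2 (ν : Measure ℝ), inferInstance, inferInstance, inferInstance, _, _, _,
      hT.succ _ (adjoint_constL_comp_constL _) (isSelfAdjoint_of_mulOperator hx)
        (adjoint_constL_comp_pow_comp_constL h hx)⟩

end HilbertModel

/-! ### Monotone independence in the vacuum state. -/

section TowerState

open scoped InnerProductSpace

lemma mem_span_pow_of_mem_adjoin {A : Type*} [Ring A] [StarRing A] [Algebra ℂ A] [StarModule ℂ A]
    {y a : A} (hy : IsSelfAdjoint y) (ha : a ∈ NonUnitalStarAlgebra.adjoin ℂ {y}) :
    a ∈ Submodule.span ℂ (Set.range fun k : ℕ => y ^ (k + 1)) := by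
  induction ha using NonUnitalStarAlgebra.adjoin_induction with
  | mem x hx =>
    rw [Set.mem_singleton_iff] at hx
    subst hx
    exact Submodule.subset_span ⟨0, by simp⟩
  | add x z _ _ hx hz => exact add_mem hx hz
  | zero => exact zero_mem _
  | mul x z _ _ hx hz =>
    have := Submodule.mul_mem_mul hx hz
    rw [Submodule.span_mul_span] at this
    refine Submodule.span_mono ?_ this
    rintro _ ⟨_, ⟨p, rfl⟩, _, ⟨q, rfl⟩, rfl⟩
    exact ⟨p + q + 1, by simp only [← pow_add]; congr 1; omega⟩
  | smul r x _ hx => exact Submodule.smul_mem _ r hx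
  | star x hmem hx =>
    clear hmem
    induction hx using Submodule.span_induction with
    | mem x hx =>
      obtain ⟨p, rfl⟩ := hx
      exact Submodule.subset_span ⟨p, by simp [hy.star_eq]⟩
    | zero => simp
    | add x z _ _ hx hz => rw [star_add]; exact add_mem hx hz
    | smul r x _ hx => rw [star_smul]; exact Submodule.smul_mem _ _ hx

variable {H : Type} [NormedAddCommGroup H] [InnerProductSpace ℂ H]

/-- The vector functional `T ↦ ⟪Ω, T Ω⟫`. -/
noncomputable def vectorState (Ω : H) : (H →L[ℂ] H) →ₗ[ℂ] ℂ where
  toFun T := ⟪Ω, T Ω⟫_ℂ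
  map_add' S T := by simp
  map_smul' c T := by simp

lemma vectorState_apply (Ω : H) (T : H →L[ℂ] H) : vectorState Ω T = ⟪Ω, T Ω⟫_ℂ := rfl

variable [CompleteSpace H] {m : ℕ → ℝ} {N : ℕ} {Ω : H} {E Y : ℕ → H →L[ℂ] H}

lemma isState_vectorState (hΩ : ‖Ω‖ = 1) : IsState (vectorState Ω) where
  nonneg T := by
    rw [vectorState_apply, mul_apply_eq_comp, ContinuousLinearMap.star_eq_adjoint,
      ContinuousLinearMap.adjoint_inner_right, inner_self_eq_norm_sq_to_K]
    exact (Complex.zero_le_real.2 (sq_nonneg ‖T Ω‖)).trans_eq (by push_cast; rfl)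
  map_one := by
    rw [vectorState_apply, one_apply_eq_self, inner_self_eq_norm_sq_to_K, hΩ]
    simp

namespace IsMonotoneTower

lemma proj_mul' (h : IsMonotoneTower m N Ω E Y) {i j : ℕ} (hij : i ≤ j) : E j * E i = E i := by
  have := congr(star $(h.proj_mul i j hij))
  rwa [star_mul, (h.proj_sa i).star_eq, (h.proj_sa j).star_eq] at this

lemma proj_apply_vac (h : IsMonotoneTower m N Ω E Y) (i : ℕ) : E i Ω = Ω := by
  have := congr($(h.proj_mul' (Nat.zero_le i)) Ω)
  rwa [mul_apply_eq_comp, h.proj_vac] at this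

lemma vectorState_mul_proj (h : IsMonotoneTower m N Ω E Y) (i : ℕ) (T : H →L[ℂ] H) :
    vectorState Ω (T * E i) = vectorState Ω T := by
  rw [vectorState_apply, mul_apply_eq_comp, h.proj_apply_vac, vectorState_apply]

lemma vectorState_proj_mul (h : IsMonotoneTower m N Ω E Y) (i : ℕ) (T : H →L[ℂ] H) :
    vectorState Ω (E i * T) = vectorState Ω T := by
  rw [vectorState_apply, mul_apply_eq_comp, ← ContinuousLinearMap.adjoint_inner_left,
    ← ContinuousLinearMap.star_eq_adjoint, (h.proj_sa i).star_eq, h.proj_apply_vac,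
    vectorState_apply]

lemma mul_proj_of_mem (h : IsMonotoneTower m N Ω E Y) {i j : ℕ} (hi : i < N) (hij : i < j)
    {a : H →L[ℂ] H} (ha : a ∈ NonUnitalStarAlgebra.adjoin ℂ {Y i}) : a * E j = a := by
  replace ha := mem_span_pow_of_mem_adjoin (h.var_sa i) ha
  induction ha using Submodule.span_induction with
  | mem x hx =>
    obtain ⟨p, rfl⟩ := hx
    have : Y i * E j = Y i := by
      rw [← h.var_mul i hi, mul_assoc, h.proj_mul _ _ hij]
    simp only [pow_succ, mul_assoc, this]
  | zero => simp
  | add x z _ _ hx hz => rw [add_mul, hx, hz]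
  | smul r x _ hx => rw [smul_mul_assoc, hx]

lemma proj_mul_of_mem (h : IsMonotoneTower m N Ω E Y) {i j : ℕ} (hi : i < N) (hij : i < j)
    {a : H →L[ℂ] H} (ha : a ∈ NonUnitalStarAlgebra.adjoin ℂ {Y i}) : E j * a = a := by
  have := congr(star $(h.mul_proj_of_mem hi hij (star_mem ha)))
  rwa [star_mul, star_star, (h.proj_sa j).star_eq] at this

lemma proj_mul_mul_proj (h : IsMonotoneTower m N Ω E Y) {i : ℕ} (hi : i < N) {a : H →L[ℂ] H}
    (ha : a ∈ NonUnitalStarAlgebra.adjoin ℂ {Y i}) :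
    E i * a * E i = vectorState Ω a • E i := by
  obtain ⟨c, hc⟩ : ∃ c : ℂ, E i * a * E i = c • E i := by
    replace ha := mem_span_pow_of_mem_adjoin (h.var_sa i) ha
    induction ha using Submodule.span_induction with
    | mem x hx =>
      obtain ⟨p, rfl⟩ := hx
      exact ⟨_, h.compress i hi (p + 1)⟩
    | zero => exact ⟨0, by simp⟩
    | add x z _ _ hx hz =>
      obtain ⟨c, hc⟩ := hx
      obtain ⟨d, hd⟩ := hz
      exact ⟨c + d, by rw [mul_add, add_mul, hc, hd, add_smul]⟩
    | smul r x _ hx =>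
      obtain ⟨c, hc⟩ := hx
      exact ⟨r * c, by rw [mul_smul_comm, smul_mul_assoc, hc, smul_smul]⟩
  have h1 : vectorState Ω a = c := by
    have h2 := congr(vectorState Ω $hc)
    rw [h.vectorState_mul_proj, h.vectorState_proj_mul, map_smul, ← one_mul (E i),
      h.vectorState_mul_proj, (isState_vectorState h.norm_vac).map_one, smul_eq_mul, mul_one] at h2
    exact h2
  rw [hc, h1]

lemma vectorState_pow (h : IsMonotoneTower m N Ω E Y) {i : ℕ} (hi : i < N) (k : ℕ) :
    vectorState Ω (Y i ^ k) = m k := by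
  have h2 := congr(vectorState Ω $(h.compress i hi k))
  rw [h.vectorState_mul_proj, h.vectorState_proj_mul, map_smul, ← one_mul (E i),
    h.vectorState_mul_proj, (isState_vectorState h.norm_vac).map_one, smul_eq_mul, mul_one] at h2
  exact h2

/-- A neighbour of lower index, or the vacuum at an end of the word, absorbs `E i`. So `E i` may be
inserted on both sides of `a`, and `E i * a * E i` is `φ a` times `E i`, which is absorbed again. -/
lemma monotoneIndep (h : IsMonotoneTower m N Ω E Y) :
    MonotoneIndep (vectorState Ω) fun i : Fin N => Y i := by
  intro u v i a hmem _ hu hv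
  simp only [List.mem_append, List.mem_cons] at hmem
  have hU : ∀ T, vectorState Ω ((u.map Prod.snd).prod * T) =
      vectorState Ω ((u.map Prod.snd).prod * (E i * T)) := by
    intro T
    rcases List.eq_nil_or_concat u with rfl | ⟨u', p, rfl⟩
    · simp [h.vectorState_proj_mul]
    · have hp := (hmem p (by simp)).1
      have hpi : p.1 < i := hu p (by simp)
      rw [List.concat_eq_append, List.map_append, List.prod_append]
      simp only [List.map_cons, List.map_nil, List.prod_cons, List.prod_nil, mul_one]
      rw [mul_assoc, mul_assoc, ← mul_assoc p.2, h.mul_proj_of_mem p.1.2 hpi hp]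
  have hV : ∀ T, vectorState Ω (T * (v.map Prod.snd).prod) =
      vectorState Ω (T * (E i * (v.map Prod.snd).prod)) := by
    intro T
    rcases v with _ | ⟨p, v⟩
    · simp [h.vectorState_mul_proj]
    · have hp := (hmem p (by simp)).1
      have hpi : p.1 < i := hv p (by simp)
      rw [List.map_cons, List.prod_cons, ← mul_assoc (E i), h.proj_mul_of_mem p.1.2 hpi hp]
  have ha := (hmem (i, a) (by simp)).1
  rw [List.map_append, List.map_append, List.prod_append, List.prod_append, List.map_cons,
    List.prod_cons, hU, ← mul_assoc, hV ((u.map Prod.snd).prod), ← mul_assoc, ← mul_assoc, hV]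
  have := h.proj_mul_mul_proj i.2 ha
  calc _ = vectorState Ω ((u.map Prod.snd).prod * (E i * a * E i) * (v.map Prod.snd).prod) := by
        simp only [mul_assoc]
    _ = _ := by
        rw [this, mul_smul_comm, smul_mul_assoc, map_smul, smul_eq_mul]

end IsMonotoneTower

end TowerState

/-! ### Monotone cumulants characterise the Poisson moments. -/

section Uniqueness

open PowerSeries

lemma coeff_pow_congr {M M' : PowerSeries ℝ} {r : ℕ} (h : ∀ k ≤ r, coeff k M = coeff k M')
    (j : ℕ) : coeff r (M ^ j) = coeff r (M' ^ j) := by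
  induction j generalizing r with
  | zero => simp
  | succ j ih =>
    rw [pow_succ, pow_succ, coeff_mul, coeff_mul]
    refine Finset.sum_congr rfl fun p hp => ?_
    have hp' := Finset.HasAntidiagonal.mem_antidiagonal.1 hp
    rw [ih fun k hk => h k (by omega), h p.2 (by omega)]

lemma coeff_X_pow_mul_pow_congr {M M' : PowerSeries ℝ} {n q : ℕ}
    (h : ∀ k ≤ n - q, coeff k M = coeff k M') (j : ℕ) :
    coeff n (X ^ q * M ^ j) = coeff n (X ^ q * M' ^ j) := by
  rw [coeff_X_pow_mul', coeff_X_pow_mul', coeff_pow_congr h]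

lemma coeff_monotoneIter_congr {M M' : PowerSeries ℝ} {n : ℕ}
    (h : ∀ k < n, coeff k M = coeff k M') (N : ℕ) {k : ℕ} (hk : k < n) :
    coeff k (monotoneIter M N) = coeff k (monotoneIter M' N) := by
  induction N generalizing k with
  | zero => rfl
  | succ N ih =>
    simp only [monotoneIter, monotoneConv, coeff_mk]
    refine Finset.sum_congr rfl fun q hq => ?_
    rw [Finset.mem_range] at hq
    rw [ih (by omega), coeff_X_pow_mul_pow_congr fun k _ => h k (by omega)]

lemma coeff_zero_monotoneIter {M : PowerSeries ℝ} (h : coeff 0 M = 1) (N : ℕ) :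
    coeff 0 (monotoneIter M N) = 1 := by
  induction N with
  | zero => simp [monotoneIter]
  | succ N ih =>
    simp only [monotoneIter, monotoneConv, coeff_mk, zero_add, Finset.sum_range_one, pow_zero,
      one_mul, pow_one, ih, h]

/-- The `n`-th moment of the `N`-fold convolution power depends on the `n`-th moment of the law as
`N` times the latter, up to a term that depends on the lower moments only. -/
lemma coeff_monotoneIter_sub {M M' : PowerSeries ℝ} {n : ℕ} (hn : 1 ≤ n)
    (h : ∀ k < n, coeff k M = coeff k M') (h0 : coeff 0 M' = 1) (N : ℕ) :
    coeff n (monotoneIter M N) - coeff n (monotoneIter M' N) = N * (coeff n M - coeff n M') := by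
  have h0' : coeff 0 M = 1 := (h 0 hn).trans h0
  induction N with
  | zero => simp [monotoneIter]
  | succ N ih =>
    have hdiag : ∀ L : PowerSeries ℝ, coeff 0 L = 1 → coeff n (X ^ n * L ^ (n + 1)) = 1 := by
      intro L hL
      rw [coeff_X_pow_mul', if_pos le_rfl, Nat.sub_self, coeff_zero_eq_constantCoeff_apply,
        map_pow, ← coeff_zero_eq_constantCoeff_apply, hL, one_pow]
    obtain ⟨d, rfl⟩ : ∃ d, n = d + 1 := ⟨n - 1, by omega⟩
    have hsum : ∑ q ∈ Finset.range d, coeff (q + 1) (monotoneIter M N) *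
        coeff (d + 1) (X ^ (q + 1) * M ^ (q + 1 + 1)) =
        ∑ q ∈ Finset.range d, coeff (q + 1) (monotoneIter M' N) *
        coeff (d + 1) (X ^ (q + 1) * M' ^ (q + 1 + 1)) := by
      refine Finset.sum_congr rfl fun q hq => ?_
      rw [Finset.mem_range] at hq
      rw [coeff_monotoneIter_congr h N (by omega),
        coeff_X_pow_mul_pow_congr fun k _ => h k (by omega)]
    have hrec : ∀ L : PowerSeries ℝ, coeff 0 L = 1 → coeff (d + 1) (monotoneIter L (N + 1)) =
        ∑ q ∈ Finset.range d, coeff (q + 1) (monotoneIter L N) *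
          coeff (d + 1) (X ^ (q + 1) * L ^ (q + 1 + 1)) + coeff (d + 1) L +
          coeff (d + 1) (monotoneIter L N) := by
      intro L hL
      rw [monotoneIter, monotoneConv, coeff_mk, Finset.sum_range_succ, Finset.sum_range_succ',
        hdiag L hL, coeff_zero_monotoneIter hL]
      simp only [pow_zero, one_mul, zero_add, pow_one, mul_one]
    rw [hrec M h0', hrec M' h0, hsum]
    push_cast
    linear_combination ih

lemma coeff_zero_poissonSeries (l : ℝ) : coeff 0 (poissonSeries l) = 1 := by
  simp [poissonSeries, poissonMatrix]

lemma coeff_two_poissonSeries_ne {l : ℝ} (hl : l ≠ 0) :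
    coeff 2 (poissonSeries l) ≠ coeff 1 (poissonSeries l) ^ 2 := by
  have h1 : coeff 1 (poissonSeries l) = l := by
    simp [poissonSeries, poissonMatrix, poissonGenerator, Finset.sum_range_succ]
  have h2 : coeff 2 (poissonSeries l) = l + l ^ 2 := by
    simp [poissonSeries, poissonMatrix, poissonGenerator, Finset.sum_range_succ, pow_two,
      Matrix.mul_apply, Fin.sum_univ_three, Fin.last]
    ring
  rw [h1, h2]
  simpa using hl

lemma isMonotonePoisson_of_hasMoments {l : ℝ} (hl : 0 < l) {ν : ProbabilityMeasure ℝ}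
    (h : HasMoments ν fun k => coeff k (poissonSeries l)) : IsMonotonePoisson l ν := by
  refine ⟨poissonPolynomial l, fun n hn => coeff_one_poissonPolynomial l hn, fun N => ?_⟩
  obtain ⟨H, _, _, _, Ω, E, Y, hT⟩ := exists_isMonotoneTower h
    (h.ae_abs_le (C := 2 * Real.exp l) (by positivity) (abs_coeff_poissonSeries_le hl.le)) N
  have hs := isState_vectorState hT.norm_vac
  refine ⟨H →L[ℂ] H, inferInstance, inferInstance, inferInstance, inferInstance, vectorState Ω,
    fun i => Y i, hs, fun i => hT.var_sa i,
    fun i => (hasDistribution_iff_hasMoments fun k => hT.vectorState_pow i.2 k).2 h,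
    hT.monotoneIndep, fun n _ => ?_⟩
  have hr : PeelRule (vectorState Ω) (fun i : Fin N => Y i) fun k => coeff k (poissonSeries l) :=
    peelRule_of_monotoneIndep hT.monotoneIndep hs.map_one (fun i k => hT.vectorState_pow i.2 k)
      (coeff_two_poissonSeries_ne hl.ne')
  have hmk : (PowerSeries.mk fun k => coeff k (poissonSeries l)) = poissonSeries l := by
    ext; simp
  rw [hr.apply_sum_pow hs.map_one, hmk, Finset.card_univ, Fintype.card_fin,
    eval_poissonPolynomial]

/-- Computed by hand because `peelRule_of_monotoneIndep` presupposes a nonzero variance. The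
coefficient of `N` shows that the second cumulant is the variance, which supplies that condition. -/
lemma apply_sum_sq_of_monotoneIndep {A : Type*} [Ring A] [StarRing A] [Algebra ℂ A]
    [StarModule ℂ A] {φ : A →ₗ[ℂ] ℂ} (h1 : φ 1 = 1) {N : ℕ} {Y : Fin N → A}
    (hind : MonotoneIndep φ Y) {m : ℕ → ℝ} (hm : ∀ i k, φ (Y i ^ k) = m k) :
    φ ((∑ i, Y i) ^ 2) = (((m 1) ^ 2 * N ^ 2 + (m 2 - (m 1) ^ 2) * N : ℝ) : ℂ) := by
  have hone : ∀ i, φ (Y i) = m 1 := fun i => by simpa using hm i 1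
  have hmul : ∀ i j, φ (Y i * Y j) = (m 1 : ℂ) ^ 2 + if i = j then (m 2 : ℂ) - m 1 ^ 2 else 0 := by
    intro i j
    split_ifs with hij
    · rw [← hij, ← sq, hm]
      ring
    · rw [add_zero]
      by_cases hi : Y i ∈ Set.range (algebraMap ℂ A)
      · obtain ⟨c, hc⟩ := hi
        have hc1 := apply_pow_of_eq_algebraMap h1 hc.symm 1
        rw [pow_one, pow_one, hone] at hc1
        rw [← hc, Algebra.algebraMap_eq_smul_one, smul_mul_assoc, one_mul, map_smul, hone, ← hc1,
          smul_eq_mul, sq]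
      by_cases hj : Y j ∈ Set.range (algebraMap ℂ A)
      · obtain ⟨c, hc⟩ := hj
        have hc1 := apply_pow_of_eq_algebraMap h1 hc.symm 1
        rw [pow_one, pow_one, hone] at hc1
        rw [← hc, Algebra.algebraMap_eq_smul_one, mul_smul_comm, mul_one, map_smul, hone, ← hc1,
          smul_eq_mul, sq]
      rw [apply_mul_of_monotoneIndep hind hij (self_mem_nonUnitalAdjoin _)
        (self_mem_nonUnitalAdjoin _) hi hj, hone, hone, sq]
  rw [sq, Finset.sum_mul_sum]
  simp only [map_sum, hmul, Finset.sum_add_distrib, Finset.sum_const, Finset.card_univ,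
    Fintype.card_fin, Finset.sum_ite_eq, Finset.mem_univ, if_true, nsmul_eq_mul]
  push_cast
  ring

lemma polynomial_eq_of_eval_natCast_eq {p q : Polynomial ℝ}
    (h : ∀ N : ℕ, p.eval (N : ℝ) = q.eval (N : ℝ)) : p = q := by
  refine Polynomial.eq_of_infinite_eval_eq p q ((Set.infinite_range_of_injective
    (Nat.cast_injective (R := ℝ))).mono ?_)
  rintro _ ⟨N, rfl⟩
  exact h N

lemma IsMonotonePoisson.hasMoments {l : ℝ} (hl : 0 < l) {ρ : ProbabilityMeasure ℝ}
    (h : IsMonotonePoisson l ρ) : HasMoments ρ fun k => coeff k (poissonSeries l) := by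
  obtain ⟨p, hp, hB⟩ := h
  set m : ℕ → ℝ := fun k => ∫ x : ℝ, x ^ k ∂(ρ : Measure ℝ) with hmdef
  have hInt : ∀ k : ℕ, Integrable (fun x : ℝ => x ^ k) (ρ : Measure ℝ) := by
    obtain ⟨B, _, _, _, _, ψ, Y, -, -, hd, -⟩ := hB 1
    exact fun k => (hd 0 k).1
  have hm0 : m 0 = 1 := by simp [hmdef]
  have hp2 : p 2 = Polynomial.C (m 1 ^ 2) * Polynomial.X ^ 2 +
      Polynomial.C (m 2 - m 1 ^ 2) * Polynomial.X := by
    refine polynomial_eq_of_eval_natCast_eq fun N => ?_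
    obtain ⟨B, _, _, _, _, ψ, Y, hs, -, hd, hind, hN⟩ := hB N
    have := (hN 2 (by norm_num)).symm.trans
      (apply_sum_sq_of_monotoneIndep hs.map_one hind fun i k => (hd i k).2)
    rw [Complex.ofReal_inj] at this
    rw [this, Polynomial.eval_add, Polynomial.eval_mul, Polynomial.eval_mul, Polynomial.eval_C,
      Polynomial.eval_C, Polynomial.eval_pow, Polynomial.eval_X]
  have hm2 : m 2 ≠ m 1 ^ 2 := by
    have := hp 2 (by norm_num)
    rw [hp2, Polynomial.coeff_add, Polynomial.coeff_C_mul, Polynomial.coeff_C_mul,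
      Polynomial.coeff_X_pow, Polynomial.coeff_X_one, if_neg (by norm_num)] at this
    intro h
    rw [h] at this
    linarith
  have heval : ∀ n, 1 ≤ n → ∀ N : ℕ, (p n).eval (N : ℝ) =
      coeff n (monotoneIter (PowerSeries.mk m) N) := by
    intro n hn N
    obtain ⟨B, _, _, _, _, ψ, Y, hs, -, hd, hind, hN⟩ := hB N
    have h1 := (hN n hn).symm.trans ((peelRule_of_monotoneIndep hind hs.map_one
      (fun i k => (hd i k).2) hm2).apply_sum_pow hs.map_one Finset.univ n)
    rwa [Complex.ofReal_inj, Finset.card_univ, Fintype.card_fin] at h1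
  have key : ∀ n, m n = coeff n (poissonSeries l) := by
    intro n
    induction n using Nat.strong_induction_on with
    | _ n ih =>
    rcases Nat.eq_zero_or_pos n with rfl | hn
    · rw [hm0, coeff_zero_poissonSeries]
    -- The lower moments agree by induction, so the two polynomials differ by a multiple of `N`;
    -- equal cumulants make it vanish.
    have hpoly : p n = poissonPolynomial l n +
        Polynomial.C (m n - coeff n (poissonSeries l)) * Polynomial.X := by
      refine polynomial_eq_of_eval_natCast_eq fun N => ?_
      have := coeff_monotoneIter_sub (M := PowerSeries.mk m) (M' := poissonSeries l) hn
        (fun k hk => by rw [coeff_mk, ih k hk]) (coeff_zero_poissonSeries l) N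
      rw [coeff_mk, ← eval_poissonPolynomial, ← heval n hn N] at this
      rw [Polynomial.eval_add, Polynomial.eval_mul, Polynomial.eval_C, Polynomial.eval_X]
      linear_combination this
    have h1 := hp n hn
    rw [hpoly, Polynomial.coeff_add, coeff_one_poissonPolynomial l hn, Polynomial.coeff_C_mul,
      Polynomial.coeff_X_one, mul_one] at h1
    linarith
  exact fun k => ⟨hInt k, key k⟩

end Uniqueness

/-! ### Convergence of the moments of the row sums. -/

section PoissonLimit

open PowerSeries

lemma tendsto_moments_rowSum {A : Type*} [CStarAlgebra A] {φ : A →ₗ[ℂ] ℂ} (hφ : IsState φ)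
    {X : ℕ → ℕ → A} {l : ℝ} (hl : 0 < l)
    (hsa : ∀ N, ∀ n ∈ Finset.Icc 1 N, IsSelfAdjoint (X N n))
    (hid : ∀ N, ∀ n ∈ Finset.Icc 1 N, ∀ k : ℕ, φ (X N n ^ k) = φ (X N 1 ^ k))
    (hind : ∀ N, MonotoneIndep φ (fun n : Set.Icc 1 N => X N n))
    (hlim : ∀ k : ℕ, 1 ≤ k →
      Tendsto (fun N : ℕ => (N : ℂ) * φ (X N 1 ^ k)) atTop (𝓝 (l : ℂ))) (k : ℕ) :
    Tendsto (fun N => (φ ((∑ n ∈ Finset.Icc 1 N, X N n) ^ k)).re) atTop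
      (𝓝 (coeff k (poissonSeries l))) := by
  let m : ℕ → ℕ → ℝ := fun N k => (φ (X N 1 ^ k)).re
  have hlim' : ∀ k, 1 ≤ k → Tendsto (fun N : ℕ => (N : ℝ) * m N k) atTop (𝓝 l) := by
    intro k hk
    have := (Complex.continuous_re.tendsto _).comp (hlim k hk)
    simpa [Function.comp_def, m] using this
  have hm1 : Tendsto (fun N : ℕ => m N 1) atTop (𝓝 0) := by
    have := (tendsto_inv_atTop_nhds_zero_nat (𝕜 := ℝ)).mul (hlim' 1 le_rfl)
    rw [zero_mul] at this
    refine this.congr' ?_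
    filter_upwards [eventually_gt_atTop 0] with N hN
    field_simp
  -- `N` times the variance tends to `l > 0`, so the rows are eventually nondegenerate and the
  -- peeling rule applies.
  have hne : ∀ᶠ N in atTop, m N 2 ≠ m N 1 ^ 2 := by
    have h1 := (hlim' 2 one_le_two).sub ((hlim' 1 le_rfl).mul hm1)
    rw [mul_zero, sub_zero] at h1
    filter_upwards [h1.eventually_ne hl.ne'] with N hN h
    refine hN ?_
    rw [h]
    ring
  have hiter : Tendsto (fun N => coeff k (monotoneIter (PowerSeries.mk (m N)) N)) atTop
      (𝓝 (coeff k (poissonSeries l))) := by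
    refine tendsto_coeff_monotoneIter (Eventually.of_forall fun N => ?_) (fun k hk => ?_) k
    · rw [← coeff_zero_eq_constantCoeff_apply, coeff_mk]
      simp [m, hφ.map_one]
    · simpa using hlim' k hk
  refine hiter.congr' ?_
  filter_upwards [hne, eventually_ge_atTop 1] with N hN hN1
  have hm : ∀ (i : Set.Icc 1 N) (k : ℕ), φ (X N i ^ k) = m N k := by
    intro i k
    rw [hid N i (Finset.mem_Icc.2 i.2)]
    exact (hφ.ofReal_re ((hsa N 1 (by simpa using hN1)).pow k)).symm
  have h := (peelRule_of_monotoneIndep (hind N) hφ.map_one hm hN).apply_sum_pow hφ.map_one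
    Finset.univ k
  have hsum : ∑ i : Set.Icc 1 N, X N i = ∑ n ∈ Finset.Icc 1 N, X N n :=
    (Finset.sum_subtype (Finset.Icc 1 N) (by simp) fun n => X N n).symm
  have hcard : (Finset.univ : Finset (Set.Icc 1 N)).card = N := by simp
  rw [hsum, hcard] at h
  rw [h, Complex.ofReal_re]

end PoissonLimit

/-- The distributions of the row sums exist and are unique, the monotone Poisson distribution exists
and is unique, and the former converge weakly to the latter. Row `N` of the array is
`X N 1, …, X N N`. -/
theorem mainTheorem5 {A : Type*} [CStarAlgebra A] (φ : A →ₗ[ℂ] ℂ) (hφ : IsState φ)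
    (X : ℕ → ℕ → A) (l : ℝ) (hl : 0 < l)
    (hsa : ∀ N, ∀ n ∈ Finset.Icc 1 N, IsSelfAdjoint (X N n))
    (hid : ∀ N, ∀ n ∈ Finset.Icc 1 N, ∀ k : ℕ, φ (X N n ^ k) = φ (X N 1 ^ k))
    (hind : ∀ N, MonotoneIndep φ (fun n : Set.Icc 1 N => X N n))
    (hlim : ∀ k : ℕ, 1 ≤ k →
      Tendsto (fun N : ℕ => (N : ℂ) * φ (X N 1 ^ k)) atTop (𝓝 (l : ℂ))) :
    ∃ (μ : ℕ → ProbabilityMeasure ℝ) (ν : ProbabilityMeasure ℝ),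
      (∀ N (ρ : ProbabilityMeasure ℝ),
        HasDistribution φ (∑ n ∈ Finset.Icc 1 N, X N n) ρ ↔ ρ = μ N) ∧
      (∀ ρ : ProbabilityMeasure ℝ, IsMonotonePoisson l ρ ↔ ρ = ν) ∧
      Tendsto μ atTop (𝓝 ν) := by
  have hS : ∀ N, IsSelfAdjoint (∑ n ∈ Finset.Icc 1 N, X N n) := fun N =>
    isSelfAdjoint_sum _ (hsa N)
  choose μ hμ hbound using fun N => hφ.exists_hasMoments (hS N)
  obtain ⟨ν, hν, hconv⟩ := exists_tendsto_of_tendsto_moments hμ (abs_coeff_poissonSeries_le hl.le)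
    (tendsto_moments_rowSum hφ hl hsa hid hind hlim)
  refine ⟨μ, ν, fun N ρ => ?_, fun ρ => ⟨fun h => ?_, ?_⟩, hconv⟩
  · rw [hasDistribution_iff_hasMoments fun k => (hφ.ofReal_re ((hS N).pow k)).symm]
    refine ⟨fun h => h.unique (hμ N) (hbound N), ?_⟩
    rintro rfl
    exact hμ N
  · exact (h.hasMoments hl).unique hν (abs_coeff_poissonSeries_le hl.le)
  · rintro rfl
    exact isMonotonePoisson_of_hasMoments hl hν
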